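/- **Setting.** Let $S^2=\{q_1^2+q_2^2+q_3^2=1\}\subset\mathbb R^3$ carry the standard area form $\omega$, with Poisson bracket $\{f,g\}$ determined by $df\wedge dg=-\{f,g\}\,\omega$, and let $\|f\|=\max|f|$. A *Berezin–Toeplitz quantization scheme* of $S^2$ is a sequence of finite-dimensional complex Hilbert spaces $H_m$ of (weakly) increasing dimension together with surjective $\mathbb R$-linear maps $T_m$ from $C^\infty(S^2)$ to the Hermitian operators on $H_m$ such that $T_m(1)=\mathrm{id}$; $T_m(f)\ge 0$ for $f\ge0$; and, for all $f,g$, as $m\to\infty$, $\|T_m(f)\|_{op}=\|f\|+O(1/m)$, $\|\,im[T_m(f),T_m(g)]-T_m(\{f,g\})\|_{op}=O(1/m)$ and $\|T_m(f^2)-T_m(f)^2\|_{op}=O(1/m)$. The Planck constant is $\hbar=1/m$. For a positive operator valued measure (POVM) $B$ on $\Theta$ and bounded measurable $u:\Theta\to\mathbb R$ put $B(u)=\int u\,dB$ and $\Delta_B(u)=B(u^2)-B(u)^2$. A POVM $A$ on $\Omega$ is a smearing of $B$ by a Markov kernel $\gamma$ from $\Theta$ to $\Omega$ if $A(X)=\int\gamma_t(X)\,dB(t)$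 for all measurable $X$; then $(\Gamma x)(t)=\int x\,d\gamma_t$. The *inherent noise* is $\mathcal N_{in}(A)=\inf_{B,\Gamma}\sup_x\|\Delta_B(\Gamma x)\|_{op}$, the infimum over all POVMs $B$ on Hausdorff locally compact second countable spaces (with Borel $\sigma$-algebras) of which $A$ is a smearing, with smearing operator $\Gamma$, the supremum over measurable $x:\Omega\to[-1,1]$. A joint observable of POVMs $\{A_i\}$, $\{B_j\}$ on finite sets is a POVM $\{C_{ij}\}$ on the product set with $\sum_jC_{ij}=A_i$ and $\sum_iC_{ij}=B_j$. The *noise indicator* of a pair of finite covers $\mathcal U,\mathcal V$ of $S^2$ is $$\mu(\mathcal U,\mathcal V)=\inf_{f,g,T}\ \inf_{C}\ \liminf_{m\to\infty} m\,\mathcal N_{in}(C^{(m)}),$$ over all smooth partitions of unity $f=\{f_i\}$, $g=\{g_j\}$ subordinated to $\mathcal U,\mathcal V$, all Berezin–Toeplitz quantization schemes $T$, and all sequences of joint observables $C^{(m)}$ of $\{T_m(f_i)\}$ and $\{T_m(g_j)\}$. For $\epsilon\in(0,1)$ and POVMs $A,E$ on $\mathbb R$, the *error bar width* $\theta$ of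 the $\epsilon$-approximation of $E$ by $A$ is the infimum (in $[0,\infty]$) of all $w>0$ such that for every $x\in\mathbb R$ and every state $\rho$ (positive operator of trace one), $\mathrm{tr}(\rho E(\{x\}))=1$ implies $\mathrm{tr}(\rho A([x-w/2,x+w/2]))\ge1-\epsilon$. **Theorem.** For every $c_1>0$ there are $c_2>0$, $c_5>0$ and $N_0\in\mathbb N$, depending only on $c_1$, such that the following holds for all $N\ge N_0$. Let $W_1,\dots,W_N$ be open intervals of length $\le c_1/N$ covering $[-1,1]$, with $-1\in W_1$, $1\in W_N$ and $W_i\cap W_j=\emptyset$ for $|i-j|\ge2$. Put $U_i=\{q\in S^2: q_1\in W_i\}$, $V_j=\{q\in S^2: q_2\in W_j\}$, $\mathcal U=\{U_i\}$, $\mathcal V=\{V_j\}$. 1. $\mu(\mathcal U,\mathcal V)\ge c_2N^2$. 2. Let $T$ be a Berezin–Toeplitz quantization scheme, $\{f_i\}$, $\{g_j\}$ smooth partitions of unity subordinated to $\mathcal U$, $\mathcal V$, and $C^{(m)}$ joint observables of $\{T_m(f_i)\}$ and $\{T_m(g_j)\}$. Let $x_k,y_k\in W_k$ be arbitrary points and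 let $\epsilon_m$ be any real sequence with $\epsilon_m\in(0,1)$ for all large $m$. Let $\theta_1$ (resp. $\theta_2$), depending on $m$, be the error bar width of the $\epsilon_m$-approximation of the spectral measure of $T_m(q_1)$ (resp. $T_m(q_2)$) by $\sum_kT_m(f_k)\delta_{x_k}$ (resp. $\sum_kT_m(g_k)\delta_{y_k}$). Then for all sufficiently large $m$ $$\mathcal N_{in}(C^{(m)})\cdot\theta_1^2\ \ge\ c_5\,\hbar,\qquad \mathcal N_{in}(C^{(m)})\cdot\theta_2^2\ \ge\ c_5\,\hbar .$$ -/

import Mathlib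

open Set Filter Topology MeasureTheory ProbabilityTheory
open scoped ENNReal NNReal Manifold ContDiff BigOperators

universe u v w

noncomputable section

namespace SpinNoise

/-! ## Positive operator valued measures -/

section POVMs

variable {H : Type u} [NormedAddCommGroup H] [InnerProductSpace ℂ H]

variable (H) in
/-- An `L(H)`-valued positive operator valued measure on the measurable space `Θ`: a countably
additive map from measurable sets to positive operators, normalized by `A(Θ) = id`. -/
structure POVM (Θ : Type v) [MeasurableSpace Θ] where
  /-- the underlying countably additive operator valued set function -/
  measure : VectorMeasure Θ (H →L[ℂ] H)
  /-- the values are positive operators -/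
  isPositive : ∀ X : Set Θ, MeasurableSet X → (measure X).IsPositive
  /-- normalization -/
  measure_univ : measure Set.univ = 1

namespace POVM

variable {Θ : Type v} [MeasurableSpace Θ]

/-- The operator valued integral `A(x) = ∫ x dA`. -/
def expect (A : POVM H Θ) (x : Θ → ℝ) : H →L[ℂ] H :=
  ∫ᵛ t, x t ∂•A.measure

/-- The noise operator `Δ_A(x) = ∫ x² dA - A(x)²`. -/
def noiseOperator (A : POVM H Θ) (x : Θ → ℝ) : H →L[ℂ] H :=
  A.expect (fun t => x t ^ 2) - A.expect x * A.expect x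

/-- The POVM `∑ i, a i • δ_{s i}` supported on finitely many points, for positive operators `a i`
which sum up to the identity. -/
def discrete {ι : Type w} [Fintype ι] (a : ι → H →L[ℂ] H) (ha : ∀ i, (a i).IsPositive)
    (hsum : ∑ i, a i = 1) (s : ι → Θ) : POVM H Θ where
  measure := ∑ i, VectorMeasure.dirac (s i) (a i)
  isPositive X hX := by
    classical
    have h : (∑ i, VectorMeasure.dirac (s i) (a i) : VectorMeasure Θ (H →L[ℂ] H)) X
        = ∑ i, VectorMeasure.dirac (s i) (a i) X := by
      rw [FunLike.coe_sum, Finset.sum_apply]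
    rw [h]
    refine ContinuousLinearMap.isPositive_sum _ fun i _ => ?_
    by_cases hi : s i ∈ X
    · rw [VectorMeasure.dirac_apply_of_mem hX hi]; exact ha i
    · rw [VectorMeasure.dirac_apply_of_notMem hi]; exact ContinuousLinearMap.isPositive_zero
  measure_univ := by
    rw [FunLike.coe_sum, Finset.sum_apply, ← hsum]
    exact Finset.sum_congr rfl fun i _ =>
      VectorMeasure.dirac_apply_of_mem MeasurableSet.univ (Set.mem_univ _)

/-- The set `K(Ω)` of measurable functions with values in `[-1, 1]`. -/
def testFunctions (Ω : Type v) [MeasurableSpace Ω] : Set (Ω → ℝ) :=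
  {x | Measurable x ∧ ∀ t, |x t| ≤ 1}

/-- `A` is the smearing of `B` by the Markov kernel `γ`: `A(X) = ∫ γ_t(X) dB(t)`. -/
def IsSmearing {Ω : Type w} [MeasurableSpace Ω] (A : POVM H Ω) (B : POVM H Θ)
    (γ : Kernel Θ Ω) : Prop :=
  ∀ X : Set Ω, MeasurableSet X → A.measure X = B.expect (fun t => (γ t).real X)

/-- The smearing operator `(Γ x)(t) = ∫ x dγ_t` of a Markov kernel. -/
def smearingOperator {Ω : Type w} [MeasurableSpace Ω] (γ : Kernel Θ Ω) (x : Ω → ℝ) : Θ → ℝ :=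
  fun t => ∫ y, x y ∂(γ t)

/-- The inherent noise
`N_in(A) = inf_{B, Γ} sup_{x ∈ K(Ω)} ‖Δ_B(Γ x)‖_op`, where `B` runs over all POVMs, on Hausdorff
locally compact second countable spaces with their Borel `σ`-algebras, of which `A` is a smearing,
and `Γ` is the corresponding smearing operator. -/
def inherentNoise {Ω : Type w} [MeasurableSpace Ω] (A : POVM H Ω) : ℝ≥0∞ :=
  sInf {r : ℝ≥0∞ | ∃ (Θ : Type v) (_ : TopologicalSpace Θ) (_ : T2Space Θ)
    (_ : LocallyCompactSpace Θ) (_ : SecondCountableTopology Θ) (_ : MeasurableSpace Θ)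
    (_ : BorelSpace Θ) (B : POVM H Θ) (γ : Kernel Θ Ω),
    IsMarkovKernel γ ∧ IsSmearing A B γ ∧
      r = ⨆ x ∈ testFunctions Ω, ‖B.noiseOperator (smearingOperator γ x)‖ₑ}

/-- `C` is a joint observable for `A` and `B`: its marginals are `A` and `B`. -/
def IsJointObservable {L N : ℕ} (C : POVM H (Fin L × Fin N)) (A : POVM H (Fin L))
    (B : POVM H (Fin N)) : Prop :=
  (∀ i, A.measure {i} = ∑ j, C.measure {(i, j)}) ∧ ∀ j, B.measure {j} = ∑ i, C.measure {(i, j)}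

end POVM

/-- The spectral measure `∑ j, P_j δ_{λ_j}` on `ℝ` of a Hermitian operator on a finite-dimensional
space, with `P_j` the projectors to the lines spanned by an orthonormal basis of eigenvectors and
`λ_j` the corresponding eigenvalues (listed with multiplicity). -/
def sharpObservable [CompleteSpace H] [FiniteDimensional ℂ H]
    (E : selfAdjoint (H →L[ℂ] H)) : POVM H ℝ :=
  have hE : ((E : H →L[ℂ] H) : H →ₗ[ℂ] H).IsSymmetric :=
    ContinuousLinearMap.isSelfAdjoint_iff_isSymmetric.mp E.2
  POVM.discrete
    (fun j => InnerProductSpace.rankOne ℂ (hE.eigenvectorBasis rfl j) (hE.eigenvectorBasis rfl j))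
    (fun _ => InnerProductSpace.isPositive_rankOne_self _)
    (by rw [OrthonormalBasis.sum_rankOne_eq_id]; rfl)
    (hE.eigenvalues rfl)

/-- A (not necessarily pure) quantum state: a positive operator of trace one. -/
def IsState (ρ : H →L[ℂ] H) : Prop :=
  ρ.IsPositive ∧ LinearMap.trace ℂ H (ρ : H →ₗ[ℂ] H) = 1

/-- The probability `ρ_B(X) = trace (ρ · B(X))`. -/
def prob (ρ : H →L[ℂ] H) (B : POVM H ℝ) (X : Set ℝ) : ℝ :=
  (LinearMap.trace ℂ H ((ρ * B.measure X : H →L[ℂ] H) : H →ₗ[ℂ] H)).re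

/-- The error bar width of the `ε`-approximation of `E` by `A`: the infimum (in `[0, ∞]`) of all
`δ > 0` such that `ρ_E({x}) = 1` implies `ρ_A([x - δ/2, x + δ/2]) ≥ 1 - ε`, for every `x ∈ ℝ` and
every state `ρ`. -/
def errorBarWidth (ε : ℝ) (A E : POVM H ℝ) : ℝ≥0∞ :=
  ⨅ (δ : ℝ) (_ : 0 < δ ∧ ∀ (x : ℝ) (ρ : H →L[ℂ] H), IsState ρ → prob ρ E {x} = 1 →
    1 - ε ≤ prob ρ A (Set.Icc (x - δ / 2) (x + δ / 2))), ENNReal.ofReal δ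

end POVMs

/-! ## The sphere and its Poisson bracket -/

/-- Euclidean three-space. -/
abbrev E3 : Type := EuclideanSpace ℝ (Fin 3)

/-- The unit sphere `S² = {q₁² + q₂² + q₃² = 1}`. -/
abbrev S2 : Type := Metric.sphere (0 : E3) 1

instance : Fact (Module.finrank ℝ E3 = 2 + 1) := ⟨finrank_euclideanSpace_fin⟩

/-- Smooth real functions on the sphere. -/
abbrev SmoothFun : Type := C^∞⟮𝓡 2, S2; 𝓘(ℝ), ℝ⟯

/-- The coordinate function `q_{k+1}` on the sphere. -/
def coord (k : Fin 3) : SmoothFun :=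
  ⟨fun q => (q : E3) k,
    ((EuclideanSpace.proj k : E3 →L[ℝ] ℝ).contDiff.contMDiff).comp contMDiff_coe_sphere⟩

/-- The uniform norm `‖f‖ = max |f|`. -/
def supNorm (f : SmoothFun) : ℝ := ⨆ q : S2, |f q|

/-- The extension of `f` to `ℝ³ \ {0}` which is constant along the rays from the origin (with an
irrelevant value at the origin). -/
def radialExt (f : SmoothFun) (x : E3) : ℝ :=
  if h : x = 0 then 0 else f ⟨‖x‖⁻¹ • x, by simp [norm_smul, h]⟩

/-- The gradient of `f` at `q` for the round metric, as a vector in `ℝ³` orthogonal to `q`. -/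
def sphereGrad (f : SmoothFun) (q : S2) : E3 := gradient (radialExt f) (q : E3)

theorem contDiffAt_radialExt (f : SmoothFun) {x : E3} (hx : x ≠ 0) :
    ContDiffAt ℝ ∞ (radialExt f) x := by
  let U : TopologicalSpace.Opens E3 := ⟨{x | x ≠ 0}, isOpen_ne⟩
  have h₁ : ContMDiff 𝓘(ℝ, E3) 𝓘(ℝ, E3) ∞ fun y : U => ‖(y : E3)‖⁻¹ • (y : E3) := by
    intro y
    refine contMDiffAt_subtype_iff (f := fun z : E3 => ‖z‖⁻¹ • z).mpr ?_
    have hy : (y : E3) ≠ 0 := y.2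
    exact (((contDiffAt_norm ℝ hy).inv (norm_ne_zero_iff.mpr hy)).smul contDiffAt_id).contMDiffAt
  have h₂ : ∀ y : U, ‖(y : E3)‖⁻¹ • (y : E3) ∈ Metric.sphere (0 : E3) 1 := fun y => by
    have hy : (y : E3) ≠ 0 := y.2
    simp [norm_smul, hy]
  have h₃ := f.contMDiff.comp (h₁.codRestrict_sphere h₂)
  have h₄ : ContMDiffAt 𝓘(ℝ, E3) 𝓘(ℝ) ∞ (radialExt f) x := by
    refine contMDiffAt_subtype_iff (U := U) (x := ⟨x, hx⟩).mp ?_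
    refine (h₃ ⟨x, hx⟩).congr_of_eventuallyEq (Eventually.of_forall fun y => ?_)
    exact dif_neg y.2
  exact h₄.contDiffAt

theorem contMDiff_sphereGrad (f : SmoothFun) (k : Fin 3) :
    ContMDiff (𝓡 2) 𝓘(ℝ) ∞ fun q : S2 => sphereGrad f q k := by
  intro q
  have hq : (q : E3) ≠ 0 := ne_zero_of_mem_unit_sphere q
  have h₁ : ContDiffAt ℝ ∞ (fderiv ℝ (radialExt f)) (q : E3) :=
    (contDiffAt_radialExt f hq).fderiv_right (by simp)
  have h₂ : ContDiffAt ℝ ∞ (fun z : E3 => gradient (radialExt f) z k) (q : E3) :=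
    ((EuclideanSpace.proj k : E3 →L[ℝ] ℝ).contDiff.contDiffAt).comp _
      ((InnerProductSpace.toDual ℝ E3).symm.contDiff.contDiffAt.comp _ h₁)
  exact h₂.contMDiffAt.comp q contMDiff_coe_sphere.contMDiffAt

/-- The Poisson bracket of the standard area form `ω` on the sphere, `ω_q(a, b) = det(q, a, b)`.
It is characterized by `df ∧ dg = -{f, g} ω`, which in coordinates with `ω = dp ∧ dq` reads
`{f, g} = ∂f/∂q · ∂g/∂p - ∂f/∂p · ∂g/∂q`; that is, `{f, g}(q) = -det(q, ∇f(q), ∇g(q))`. -/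
def poissonBracket (f g : SmoothFun) : SmoothFun :=
  ⟨fun q => -Matrix.det
      (Matrix.of ![(q : E3).ofLp, (sphereGrad f q).ofLp, (sphereGrad g q).ofLp]), by
    have hq (k : Fin 3) : ContMDiff (𝓡 2) 𝓘(ℝ) ∞ fun q : S2 => (q : E3).ofLp k :=
      (coord k).contMDiff
    have hf := contMDiff_sphereGrad f
    have hg := contMDiff_sphereGrad g
    have H (i j k : Fin 3) : ContMDiff (𝓡 2) 𝓘(ℝ) ∞ fun q : S2 =>
        (q : E3).ofLp i * (sphereGrad f q).ofLp j * (sphereGrad g q).ofLp k :=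
      ((hq i).mul (hf j)).mul (hg k)
    have h : ∀ q : S2, -Matrix.det
        (Matrix.of ![(q : E3).ofLp, (sphereGrad f q).ofLp, (sphereGrad g q).ofLp]) = _ := fun q => congrArg Neg.neg (Matrix.det_fin_three _)
    refine ContMDiff.congr ?_ h
    exact ((((((H 0 1 2).sub (H 0 2 1)).sub (H 1 0 2)).add (H 1 2 0)).add (H 2 0 1)).sub
      (H 2 1 0)).neg⟩

/-! ## Berezin-Toeplitz quantization and noise indicators -/

/-- A scheme of the Berezin-Toeplitz quantization of the sphere with the standard area form. -/
structure BTQuantization where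
  /-- the quantum Hilbert spaces -/
  H : ℕ → Type u
  [normedAddCommGroup : ∀ m, NormedAddCommGroup (H m)]
  [innerProductSpace : ∀ m, InnerProductSpace ℂ (H m)]
  [completeSpace : ∀ m, CompleteSpace (H m)]
  [finiteDimensional : ∀ m, FiniteDimensional ℂ (H m)]
  /-- the dimensions increase -/
  dim_mono : Monotone fun m => Module.finrank ℂ (H m)
  /-- the quantization maps, from smooth functions to Hermitian operators -/
  T : ∀ m, SmoothFun →ₗ[ℝ] selfAdjoint (H m →L[ℂ] H m)
  surjective : ∀ m, Function.Surjective (T m)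
  map_one : ∀ m, (T m 1 : H m →L[ℂ] H m) = 1
  map_nonneg : ∀ m f, (∀ q, 0 ≤ f q) → (T m f : H m →L[ℂ] H m).IsPositive
  norm_asymp : ∀ f, (fun m => ‖(T m f : H m →L[ℂ] H m)‖ - supNorm f)
    =O[atTop] fun m : ℕ => 1 / (m : ℝ)
  correspondence : ∀ f g,
    (fun m : ℕ => ‖(Complex.I * (m : ℂ)) • ((T m f : H m →L[ℂ] H m) * T m g - T m g * T m f)
      - (T m (poissonBracket f g) : H m →L[ℂ] H m)‖) =O[atTop] fun m : ℕ => 1 / (m : ℝ)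
  quasi_mult : ∀ f,
    (fun m : ℕ => ‖(T m (f * f) : H m →L[ℂ] H m) - (T m f : H m →L[ℂ] H m) * T m f‖)
      =O[atTop] fun m : ℕ => 1 / (m : ℝ)

attribute [instance] BTQuantization.normedAddCommGroup BTQuantization.innerProductSpace
  BTQuantization.completeSpace BTQuantization.finiteDimensional

/-- Smooth partitions of unity on the sphere indexed by `{1, ..., L}`. -/
abbrev Partition (L : ℕ) : Type := SmoothPartitionOfUnity (Fin L) (𝓡 2) S2 Set.univ

theorem Partition.sum_eq_one_smooth {L : ℕ} (f : Partition L) : ∑ i, f i = (1 : SmoothFun) := by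
  ext q
  have h := f.sum_eq_one (Set.mem_univ q)
  rw [finsum_eq_sum_of_fintype] at h
  have h₂ : (∑ i, f i : SmoothFun) q = ∑ i, f i q :=
    (congrFun (map_sum (ContMDiffMap.coeFnAddMonoidHom (I := 𝓡 2) (N := S2) (I' := 𝓘(ℝ))
      (G := ℝ) (n := ∞)) (fun i => f i) Finset.univ) q).trans (Finset.sum_apply _ _ _)
  rw [h₂, h]
  rfl

namespace BTQuantization

theorem sum_partition (Q : BTQuantization.{u}) (m : ℕ) {L : ℕ} (f : Partition L) :
    ∑ i, (Q.T m (f i) : Q.H m →L[ℂ] Q.H m) = 1 := by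
  rw [← Q.map_one m, ← f.sum_eq_one_smooth, map_sum, AddSubgroup.val_finsetSum]

/-- The POVM `A^{(m)} = {T_m(f_i)}` on `{1, ..., L}`, where `f` is a partition of unity. -/
def registration (Q : BTQuantization.{u}) (m : ℕ) {L : ℕ} (f : Partition L) :
    POVM (Q.H m) (Fin L) :=
  POVM.discrete (fun i => (Q.T m (f i) : Q.H m →L[ℂ] Q.H m))
    (fun i => Q.map_nonneg m (f i) fun q => f.nonneg i q) (Q.sum_partition m f) id

/-- The POVM `∑ k, T_m(f_k) δ_{x_k}` on `ℝ`. -/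
def realRegistration (Q : BTQuantization.{u}) (m : ℕ) {L : ℕ} (f : Partition L)
    (x : Fin L → ℝ) : POVM (Q.H m) ℝ :=
  POVM.discrete (fun i => (Q.T m (f i) : Q.H m →L[ℂ] Q.H m))
    (fun i => Q.map_nonneg m (f i) fun q => f.nonneg i q) (Q.sum_partition m f) x

/-- `C = (C^{(m)})` is a sequence of joint observables for `{T_m(f_i)}` and `{T_m(g_j)}`. -/
def IsJointSequence (Q : BTQuantization.{u}) {L N : ℕ} (f : Partition L) (g : Partition N)
    (C : ∀ m, POVM (Q.H m) (Fin L × Fin N)) : Prop :=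
  ∀ m, (C m).IsJointObservable (Q.registration m f) (Q.registration m g)

/-- `μ_T(f, g) = inf_C liminf_{m → ∞} m · N_in(C^{(m)})`, where `C` runs over all sequences of joint
observables for `{T_m(f_i)}` and `{T_m(g_j)}`. -/
def noiseIndicator (Q : BTQuantization.{u}) {L N : ℕ} (f : Partition L) (g : Partition N) : ℝ≥0∞ :=
  ⨅ (C : ∀ m, POVM (Q.H m) (Fin L × Fin N)) (_ : Q.IsJointSequence f g C),
    liminf (fun m : ℕ => (m : ℝ≥0∞) * POVM.inherentNoise.{u, v, 0} (C m)) atTop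

end BTQuantization

/-- The noise indicator `μ(U, V) = inf_{f, g, T} μ_T(f, g)` of a pair of finite covers of the sphere;
the infimum is over all partitions of unity `f`, `g` subordinated to `U`, `V` respectively and over
all schemes of the Berezin-Toeplitz quantization. -/
def noiseIndicator {L N : ℕ} (U : Fin L → Set S2) (V : Fin N → Set S2) : ℝ≥0∞ :=
  ⨅ (Q : BTQuantization.{u}) (f : Partition L) (_ : f.IsSubordinate U)
    (g : Partition N) (_ : g.IsSubordinate V), BTQuantization.noiseIndicator.{u, v} Q f g

/-! ## The covers -/

/-- `W_1, ..., W_N` is a cover of `[-1, 1]` by open intervals of length at most `c / N`, with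
`-1 ∈ W_1`, `1 ∈ W_N` and `W_i ∩ W_j = ∅` for `|i - j| ≥ 2`. -/
structure IsIntervalCover (c : ℝ) {N : ℕ} (W : Fin N → Set ℝ) : Prop where
  isInterval : ∀ i, ∃ a b : ℝ, a < b ∧ b - a ≤ c / N ∧ W i = Set.Ioo a b
  covers : Set.Icc (-1 : ℝ) 1 ⊆ ⋃ i, W i
  first : ∀ i : Fin N, (i : ℕ) = 0 → (-1 : ℝ) ∈ W i
  last : ∀ i : Fin N, (i : ℕ) + 1 = N → (1 : ℝ) ∈ W i
  disjoint : ∀ i j : Fin N, 2 ≤ |(i : ℤ) - (j : ℤ)| → W i ∩ W j = ∅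

/-- The sets `{q ∈ S² : q_{k+1} ∈ W_i}`. -/
def coordCover (k : Fin 3) {N : ℕ} (W : Fin N → Set ℝ) (i : Fin N) : Set S2 :=
  {q | coord k q ∈ W i}

end SpinNoise

end

noncomputable section

namespace SpinNoise

/-! ### Norm bounds for Hermitian and positive operators. -/

section OperatorNorms

variable {H : Type u} [NormedAddCommGroup H] [InnerProductSpace ℂ H]

/-! Two lower bounds are multiplied: the noise is at least a constant times `N² ħ`, and the error
bars are at least `1 / N` wide.

Noise. For any POVM `B`, Kadison–Schwarz applied to `x + i y` gives the unsharpness principle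
`‖[B(x), B(y)]‖ ≤ ‖Δ_B(x)‖ + ‖Δ_B(y)‖` (`POVM.norm_commutator_expect_le`). If `B` smears to a joint
observable, functions of one index recover combinations of either marginal. Hence half the
commutator norm of any two combinations `T_m(F)`, `T_m(G)`, with coefficients in `[-1, 1]`, bounds
the inherent noise from below. By the correspondence principle this commutator has size about `‖{F,
G}‖ / m`.

To make the bracket large, let the coefficients jump from `-1` to `1` between two consecutive
intervals near `0`. Then `F` goes from `-1` to `1` as `q₁` crosses their overlap `(a, b)`, and `G`
likewise in `q₂`. The pair `(F, G)` maps the sides of `[a, b]²` into the corresponding sides of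
`[-1, 1]²`, so Green's formula makes its Jacobian integrate to `4` over an area of at most `(c /
N)²`. As `q₃ ≥ 1/2` there, `‖{F, G}‖ ≥ 2 N² / c²` (`IsIntervalCover.exists_large_poissonBracket`).

Error bars. By pigeonhole, `N` values leave some `p ∈ [-1, 1]` at distance at least `1 / N` from all
of them. The spectrum of `T_m(q_k)` becomes dense in `[-1, 1]`, so some eigenvalue lies close to
`p`, and its eigenstate forces the error bar to be wide. In the product with the noise bound the
powers of `N` cancel. -/

theorem norm_le_of_abs_re_inner_le {S : H →L[ℂ] H} (hS : (S : H →ₗ[ℂ] H).IsSymmetric) {c : ℝ}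
    (hc : 0 ≤ c) (h : ∀ ξ, |(inner ℂ (S ξ) ξ).re| ≤ c * ‖ξ‖ ^ 2) : ‖S‖ ≤ c := by
  rw [ContinuousLinearMap.norm_eq_iSup_rayleighQuotient S hS]
  refine ciSup_le fun ξ => ?_
  rw [ContinuousLinearMap.rayleighQuotient, ContinuousLinearMap.reApplyInnerSelf_apply, abs_div,
    abs_of_nonneg (sq_nonneg ‖ξ‖)]
  exact div_le_of_le_mul₀ (sq_nonneg _) hc (h ξ)

theorem re_inner_le_norm_mul (S : H →L[ℂ] H) (ξ : H) :
    (inner ℂ (S ξ) ξ).re ≤ ‖S‖ * ‖ξ‖ ^ 2 := by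
  calc (inner ℂ (S ξ) ξ).re ≤ ‖S ξ‖ * ‖ξ‖ := re_inner_le_norm (𝕜 := ℂ) _ _
    _ ≤ ‖S‖ * ‖ξ‖ * ‖ξ‖ := by gcongr; exact S.le_opNorm ξ
    _ = ‖S‖ * ‖ξ‖ ^ 2 := by ring

/-- A positive operator is a sum of operators `u ⊗ u*`, and for each of these the norm equals the
trace. -/
theorem norm_le_re_trace [FiniteDimensional ℂ H] {S : H →L[ℂ] H} (hS : S.IsPositive) :
    ‖S‖ ≤ (LinearMap.trace ℂ H (S : H →ₗ[ℂ] H)).re := by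
  obtain ⟨n, u, rfl⟩ := ContinuousLinearMap.isPositive_iff_eq_sum_rankOne.mp hS
  have h : ((∑ i, InnerProductSpace.rankOne ℂ (u i) (u i) : H →L[ℂ] H) : H →ₗ[ℂ] H)
      = ∑ i, ((InnerProductSpace.rankOne ℂ (u i) (u i) : H →L[ℂ] H) : H →ₗ[ℂ] H) := by
    ext ξ; simp
  rw [h, map_sum, Complex.re_sum]
  refine (norm_sum_le _ _).trans (Finset.sum_le_sum fun i _ => ?_)
  rw [InnerProductSpace.norm_rankOne, InnerProductSpace.trace_rankOne]
  exact (inner_self_eq_norm_mul_norm (𝕜 := ℂ) (u i)).ge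

end OperatorNorms

/-! ### Integration against POVMs, Kadison–Schwarz and the unsharpness principle. -/

namespace POVM

variable {H : Type u} [NormedAddCommGroup H] [InnerProductSpace ℂ H]
  [FiniteDimensional ℂ H] {Θ : Type v} [MeasurableSpace Θ] (B : POVM H Θ)

/-- Since `‖B(E)‖ ≤ tr B(E)`, the variation is dominated by that of the finite signed measure `Re tr
B`. Bounded measurable functions are therefore integrable and dominated convergence applies. -/
instance isFiniteMeasure_variation :
    IsFiniteMeasure (VectorMeasure.variation (V := H →L[ℂ] H) B.measure) := by
  let φ : (H →L[ℂ] H) →ₗ[ℝ] ℝ :=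
    { toFun := fun S => (LinearMap.trace ℂ H (S : H →ₗ[ℂ] H)).re
      map_add' := fun S T => by
        rw [ContinuousLinearMap.toLinearMap_add, map_add, Complex.add_re]
      map_smul' := fun c S => by
        have : ((c • S : H →L[ℂ] H) : H →ₗ[ℂ] H) = (c : ℂ) • (S : H →ₗ[ℂ] H) := by
          ext ξ; simp
        rw [this, map_smul]; simp }
  have : FiniteDimensional ℝ (H →L[ℂ] H) := FiniteDimensional.complexToReal _
  have hφ : Continuous φ := φ.continuous_of_finiteDimensional
  let s : SignedMeasure Θ := B.measure.mapRange φ.toAddMonoidHom hφ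
  have : IsFiniteMeasure s.variation := by
    rw [← SignedMeasure.totalVariation_eq_variation]; infer_instance
  refine isFiniteMeasure_of_le s.variation
    (VectorMeasure.variation_le_of_forall_enorm_le fun E hE => ?_)
  refine le_trans ?_ (VectorMeasure.enorm_measure_le_variation s E)
  have h : ‖B.measure E‖ ≤ s E := norm_le_re_trace (B.isPositive E hE)
  rw [enorm_le_iff_norm_le]
  exact h.trans (le_abs_self _)

theorem integrable_of_bounded {x : Θ → ℝ} (hx : Measurable x) {R : ℝ} (h : ∀ t, |x t| ≤ R) :
    B.measure.Integrable x :=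
  Integrable.of_bound hx.aestronglyMeasurable R (Eventually.of_forall h)

theorem expect_comp_simpleFunc {γ : Type*} (φ : SimpleFunc Θ γ) (c : γ → ℝ) :
    B.expect (fun t => c (φ t)) = ∑ z ∈ φ.range, c z • B.measure (φ ⁻¹' {z}) := by
  classical
  have h : (fun t => c (φ t)) =
      fun t => ∑ z ∈ φ.range, (φ ⁻¹' {z}).indicator (fun _ => c z) t := by
    ext t
    rw [Finset.sum_eq_single (φ t)]
    · simp
    · intro z _ hz
      exact indicator_of_notMem (fun h => hz h.symm) _
    · intro h; exact absurd (φ.mem_range_self t) h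
  rw [expect, h, VectorMeasure.integral_finsetSum]
  · refine Finset.sum_congr rfl fun z _ => ?_
    rw [VectorMeasure.integral_indicator_const _ (φ.measurableSet_fiber z)]
    rfl
  · intro z _
    exact (integrable_const (c z)).indicator (φ.measurableSet_fiber z)

theorem sum_measure_fiber {γ : Type*} (φ : SimpleFunc Θ γ) :
    ∑ z ∈ φ.range, B.measure (φ ⁻¹' {z}) = 1 := by
  have h := B.expect_comp_simpleFunc φ fun _ => 1
  simp only [one_smul] at h
  rw [← h, expect, VectorMeasure.integral_const, B.measure_univ]
  simp

/-- Approximation of two bounded functions by the two components of simple functions. -/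
theorem exists_simpleFunc_tendsto {x y : Θ → ℝ} (hx : Measurable x) (hy : Measurable y) {R : ℝ}
    (hxR : ∀ t, |x t| ≤ R) (hyR : ∀ t, |y t| ≤ R) :
    ∃ φ : ℕ → SimpleFunc Θ (ℝ × ℝ), ∀ c : ℝ × ℝ → ℝ, Continuous c →
      Tendsto (fun n => B.expect fun t => c (φ n t)) atTop
        (𝓝 (B.expect fun t => c (x t, y t))) := by
  rcases isEmpty_or_nonempty Θ with hΘ | ⟨⟨t₀⟩⟩
  · refine ⟨fun _ => SimpleFunc.const _ 0, fun c _ => ?_⟩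
    have : (fun t => c (x t, y t)) = fun t : Θ => c ((SimpleFunc.const Θ (0 : ℝ × ℝ)) t) :=
      funext fun t => hΘ.elim t
    rw [this]
    exact tendsto_const_nhds
  -- Approximants with values in this compact square make `c` uniformly bounded along them, which
  -- supplies the dominating constant.
  set s : Set (ℝ × ℝ) := Icc (-R) R ×ˢ Icc (-R) R
  have hs (t : Θ) : (x t, y t) ∈ s := ⟨abs_le.mp (hxR t), abs_le.mp (hyR t)⟩
  have hsc : IsCompact s := isCompact_Icc.prod isCompact_Icc
  refine ⟨SimpleFunc.approxOn (fun t => (x t, y t)) (hx.prodMk hy) s _ (hs t₀), fun c hc => ?_⟩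
  obtain ⟨K, hK⟩ := hsc.exists_bound_of_continuousOn hc.continuousOn
  refine VectorMeasure.tendsto_integral_of_dominated_convergence (fun _ => K) ?_
    (integrable_const K) ?_ ?_
  · intro n
    exact (hc.measurable.comp (SimpleFunc.measurable _)).aestronglyMeasurable
  · intro n
    exact Eventually.of_forall fun t => hK _ (SimpleFunc.approxOn_mem _ (hs t₀) n t)
  · exact Eventually.of_forall fun t => (hc.tendsto _).comp
      (SimpleFunc.tendsto_approxOn _ (hs t₀) (subset_closure (hs t)))

theorem isSymmetric_expect {x : Θ → ℝ} (hx : Measurable x) {R : ℝ} (hxR : ∀ t, |x t| ≤ R) :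
    (B.expect x : H →ₗ[ℂ] H).IsSymmetric := by
  obtain ⟨φ, hφ⟩ := B.exists_simpleFunc_tendsto hx hx hxR hxR
  have h := hφ Prod.fst continuous_fst
  intro ξ η
  have hl : Tendsto (fun n => inner ℂ (B.expect (fun t => (φ n t).1) ξ) η) atTop
      (𝓝 (inner ℂ (B.expect x ξ) η)) :=
    (((ContinuousLinearMap.apply ℂ H ξ).continuous.tendsto _).comp h).inner tendsto_const_nhds
  have hr : Tendsto (fun n => inner ℂ ξ (B.expect (fun t => (φ n t).1) η)) atTop
      (𝓝 (inner ℂ ξ (B.expect x η))) :=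
    Tendsto.inner tendsto_const_nhds (((ContinuousLinearMap.apply ℂ H η).continuous.tendsto _).comp h)
  refine tendsto_nhds_unique hl (hr.congr fun n => ?_)
  rw [B.expect_comp_simpleFunc (φ n) Prod.fst]
  simp only [FunLike.coe_sum, Finset.sum_apply, sum_inner, inner_sum]
  refine Finset.sum_congr rfl fun z _ => ?_
  have := (B.isPositive _ ((φ n).measurableSet_fiber z)).inner_left_eq_inner_right ξ η
  rw [FunLike.coe_smul, Pi.smul_apply, Pi.smul_apply, ← Complex.coe_smul, ← Complex.coe_smul,
    inner_smul_left, inner_smul_right, this]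
  simp

/-- The Kadison–Schwarz inequality `B(w)* B(w) ≤ B(|w|²)` for a simple function `w`. -/
theorem norm_sq_le_of_simpleFunc (φ : SimpleFunc Θ (ℝ × ℝ)) (ξ : H) :
    ‖B.expect (fun t => (φ t).1) ξ + Complex.I • B.expect (fun t => (φ t).2) ξ‖ ^ 2 ≤
      (inner ℂ (B.expect (fun t => (φ t).1 ^ 2 + (φ t).2 ^ 2) ξ) ξ).re := by
  set η := B.expect (fun t => (φ t).1) ξ + Complex.I • B.expect (fun t => (φ t).2) ξ with hη
  let w : ℝ × ℝ → ℂ := fun z => z.1 + z.2 * Complex.I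
  let P : ℝ × ℝ → H →L[ℂ] H := fun z => B.measure (φ ⁻¹' {z})
  have hP (z) : (P z).IsPositive := B.isPositive _ (φ.measurableSet_fiber z)
  have hη' : η = ∑ z ∈ φ.range, w z • P z ξ := by
    rw [hη, B.expect_comp_simpleFunc φ Prod.fst, B.expect_comp_simpleFunc φ Prod.snd]
    simp only [FunLike.coe_sum, Finset.sum_apply, Finset.smul_sum]
    rw [← Finset.sum_add_distrib]
    refine Finset.sum_congr rfl fun z _ => ?_
    simp only [FunLike.coe_smul, Pi.smul_apply, ← Complex.coe_smul, smul_smul, ← add_smul, w, P]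
    rw [mul_comm Complex.I]
  have h1 : ∑ z ∈ φ.range, (inner ℂ (P z η) η).re = ‖η‖ ^ 2 := by
    rw [← Complex.re_sum, ← sum_inner]
    have : ∑ z ∈ φ.range, P z η = η := by
      rw [← Finset.sum_apply, ← FunLike.coe_sum, B.sum_measure_fiber φ]; rfl
    rw [this, inner_self_eq_norm_sq_to_K]
    norm_cast
  have h2 : ∑ z ∈ φ.range, (inner ℂ (w z • P z ξ) η).re = ‖η‖ ^ 2 := by
    rw [← Complex.re_sum, ← sum_inner, ← hη', inner_self_eq_norm_sq_to_K]
    norm_cast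
  have h3 : (inner ℂ (B.expect (fun t => (φ t).1 ^ 2 + (φ t).2 ^ 2) ξ) ξ).re =
      ∑ z ∈ φ.range, (z.1 ^ 2 + z.2 ^ 2) * (inner ℂ (P z ξ) ξ).re := by
    rw [B.expect_comp_simpleFunc φ fun z => z.1 ^ 2 + z.2 ^ 2]
    simp only [FunLike.coe_sum, Finset.sum_apply, sum_inner, Complex.re_sum]
    refine Finset.sum_congr rfl fun z _ => ?_
    rw [FunLike.coe_smul, Pi.smul_apply, ← Complex.coe_smul, inner_smul_left, Complex.conj_ofReal,
      Complex.re_ofReal_mul]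
  -- This is `⟨P_z ζ, ζ⟩ ≥ 0` for `ζ = w_z ξ - η`. As the `P_z` sum to the identity and `η = ∑ w_z
  -- P_z ξ`, summation leaves `⟨B(|w|²) ξ, ξ⟩ - 2 ‖η‖² + ‖η‖² ≥ 0`.
  have h4 : ∀ z, 0 ≤ (z.1 ^ 2 + z.2 ^ 2) * (inner ℂ (P z ξ) ξ).re
      - 2 * (inner ℂ (w z • P z ξ) η).re + (inner ℂ (P z η) η).re := by
    intro z
    have h := (hP z).re_inner_nonneg_left (w z • ξ - η)
    have e1 : inner ℂ (P z η) (w z • ξ) = (starRingEnd ℂ) (inner ℂ (w z • P z ξ) η) := by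
      rw [inner_conj_symm, (hP z).inner_left_eq_inner_right, map_smul]
    have e2 : (inner ℂ (w z • P z ξ) (w z • ξ)).re
        = (z.1 ^ 2 + z.2 ^ 2) * (inner ℂ (P z ξ) ξ).re := by
      rw [inner_smul_left, inner_smul_right, ← mul_assoc, ← Complex.normSq_eq_conj_mul_self,
        Complex.re_ofReal_mul, Complex.normSq_add_mul_I]
    rw [map_sub, map_smul, inner_sub_left, inner_sub_right, inner_sub_right, e1] at h
    simp only [RCLike.re_eq_complex_re, Complex.sub_re, Complex.conj_re, e2] at h
    linarith
  have h5 := Finset.sum_nonneg fun z (_ : z ∈ φ.range) => h4 z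
  rw [Finset.sum_add_distrib, Finset.sum_sub_distrib, ← Finset.mul_sum, h1, h2, ← h3] at h5
  linarith

/-- The Kadison–Schwarz inequality `B(w)* B(w) ≤ B(|w|²)` for `w = x + i y`. -/
theorem norm_sq_expect_add_le {x y : Θ → ℝ} (hx : Measurable x) (hy : Measurable y) {R : ℝ}
    (hxR : ∀ t, |x t| ≤ R) (hyR : ∀ t, |y t| ≤ R) (ξ : H) :
    ‖B.expect x ξ + Complex.I • B.expect y ξ‖ ^ 2 ≤
      (inner ℂ (B.expect (fun t => x t ^ 2 + y t ^ 2) ξ) ξ).re := by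
  obtain ⟨φ, hφ⟩ := B.exists_simpleFunc_tendsto hx hy hxR hyR
  have ev (c : ℝ × ℝ → ℝ) (hc : Continuous c) :=
    ((ContinuousLinearMap.apply ℂ H ξ).continuous.tendsto _).comp (hφ c hc)
  have h1 := ev Prod.fst continuous_fst
  have h2 := ev Prod.snd continuous_snd
  have h3 := ev (fun z => z.1 ^ 2 + z.2 ^ 2) (by fun_prop)
  exact le_of_tendsto_of_tendsto' ((h1.add (h2.const_smul Complex.I)).norm.pow 2)
    ((Complex.continuous_re.tendsto _).comp (h3.inner tendsto_const_nhds))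
    fun n => B.norm_sq_le_of_simpleFunc (φ n) ξ

/-- Expand Kadison–Schwarz for `x + i y`: the squares `‖B(x) ξ‖²`, `‖B(y) ξ‖²` turn the second
moments into noise operators, and only the cross term survives on the left. -/
theorem im_inner_expect_le {x y : Θ → ℝ} (hx : Measurable x) (hy : Measurable y) {R : ℝ}
    (hxR : ∀ t, |x t| ≤ R) (hyR : ∀ t, |y t| ≤ R) (ξ : H) :
    -2 * (inner ℂ (B.expect x ξ) (B.expect y ξ)).im ≤
      (‖B.noiseOperator x‖ + ‖B.noiseOperator y‖) * ‖ξ‖ ^ 2 := by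
  have h := B.norm_sq_expect_add_le hx hy hxR hyR ξ
  have hsq {z : Θ → ℝ} (hz : Measurable z) (hzR : ∀ t, |z t| ≤ R) :
      B.measure.Integrable fun t => z t ^ 2 :=
    B.integrable_of_bounded (hz.pow_const 2) (R := R ^ 2) fun t => by
      rw [abs_pow]; exact pow_le_pow_left₀ (abs_nonneg _) (hzR t) 2
  have hadd : B.expect (fun t => x t ^ 2 + y t ^ 2)
      = B.expect (fun t => x t ^ 2) + B.expect (fun t => y t ^ 2) :=
    VectorMeasure.integral_fun_add (hsq hx hxR) (hsq hy hyR)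
  have hn {z : Θ → ℝ} (hz : Measurable z) (hzR : ∀ t, |z t| ≤ R) :
      (inner ℂ (B.expect (fun t => z t ^ 2) ξ) ξ).re =
        (inner ℂ (B.noiseOperator z ξ) ξ).re + ‖B.expect z ξ‖ ^ 2 := by
    have hs : inner ℂ (B.expect z (B.expect z ξ)) ξ = inner ℂ (B.expect z ξ) (B.expect z ξ) :=
      B.isSymmetric_expect hz hzR _ _
    have hr : (inner ℂ (B.expect z ξ) (B.expect z ξ)).re = ‖B.expect z ξ‖ ^ 2 := by
      rw [inner_self_eq_norm_sq_to_K]; norm_cast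
    rw [noiseOperator, sub_apply, mul_apply_eq_comp,
      inner_sub_left, hs, Complex.sub_re, hr]
    ring
  rw [hadd, add_apply, inner_add_left, Complex.add_re, hn hx hxR, hn hy hyR,
    norm_add_sq (𝕜 := ℂ), norm_smul, Complex.norm_I, one_mul, inner_smul_right] at h
  have h1 := re_inner_le_norm_mul (B.noiseOperator x) ξ
  have h2 := re_inner_le_norm_mul (B.noiseOperator y) ξ
  simp only [RCLike.re_eq_complex_re, Complex.I_mul_re] at h
  linarith

/-- The unsharpness principle: noncommuting statistics produce noise. -/
theorem norm_commutator_expect_le {x y : Θ → ℝ} (hx : Measurable x) (hy : Measurable y) {R : ℝ}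
    (hxR : ∀ t, |x t| ≤ R) (hyR : ∀ t, |y t| ≤ R) :
    ‖B.expect x * B.expect y - B.expect y * B.expect x‖ ≤
      ‖B.noiseOperator x‖ + ‖B.noiseOperator y‖ := by
  set U := B.expect x with hU
  set V := B.expect y with hV
  have sU : ∀ ξ η, inner ℂ (U ξ) η = inner ℂ ξ (U η) := B.isSymmetric_expect hx hxR
  have sV : ∀ ξ η, inner ℂ (V ξ) η = inner ℂ ξ (V η) := B.isSymmetric_expect hy hyR
  -- Multiplication by `i` makes the commutator symmetric, so its norm can be read off its quadratic
  -- form.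
  have hn : ‖U * V - V * U‖ = ‖Complex.I • (U * V - V * U)‖ := by
    rw [norm_smul, Complex.norm_I, one_mul]
  rw [hn]
  refine norm_le_of_abs_re_inner_le ?_ (by positivity) fun ξ => ?_
  · intro ξ η
    simp [inner_smul_left, inner_smul_right, inner_sub_left, inner_sub_right, sU, sV]
    ring
  -- Exchanging `x` and `y` reverses the sign of the cross term, which gives the two-sided bound.
  · have h1 := B.im_inner_expect_le hx hy hxR hyR ξ
    have h2 := B.im_inner_expect_le hy hx hyR hxR ξ
    have h3 : (inner ℂ (V ξ) (U ξ)).im = -(inner ℂ (U ξ) (V ξ)).im := by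
      rw [← inner_conj_symm, Complex.conj_im]
    have h4 : (inner ℂ ((Complex.I • (U * V - V * U)) ξ) ξ).re
        = -2 * (inner ℂ (U ξ) (V ξ)).im := by
      simp only [smul_apply, sub_apply,
        mul_apply_eq_comp, inner_smul_left, inner_sub_left, sU, sV, Complex.conj_I]
      rw [← sU, ← sV]
      simp [h3]
      ring
    rw [h4, abs_le]
    constructor <;> linarith

theorem smearingOperator_eq_sum {Ω : Type w} [Fintype Ω] [MeasurableSpace Ω]
    [MeasurableSingletonClass Ω] (γ : Kernel Θ Ω) [IsMarkovKernel γ] (x : Ω → ℝ) :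
    smearingOperator γ x = fun t => ∑ p, x p • (γ t).real {p} := by
  ext t
  rw [smearingOperator, integral_fintype Integrable.of_finite]
  simp [mul_comm]

variable {B} in
theorem IsSmearing.expect_smearingOperator {Ω : Type w} [Fintype Ω] [MeasurableSpace Ω]
    [MeasurableSingletonClass Ω] {C : POVM H Ω} {γ : Kernel Θ Ω} [IsMarkovKernel γ]
    (h : IsSmearing C B γ) (x : Ω → ℝ) :
    B.expect (smearingOperator γ x) = ∑ p, x p • C.measure {p} := by
  have hint (p : Ω) : B.measure.Integrable fun t => (γ t).real {p} :=
    B.integrable_of_bounded (R := 1) (γ.measurable_coe (measurableSet_singleton p)).ennreal_toReal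
      fun t => by rw [abs_of_nonneg measureReal_nonneg]; exact measureReal_le_one
  rw [smearingOperator_eq_sum, expect,
    VectorMeasure.integral_finsetSum _ fun p _ => VectorMeasure.Integrable.fun_smul (x p) (hint p)]
  refine Finset.sum_congr rfl fun p _ => ?_
  rw [VectorMeasure.integral_fun_smul, h _ (measurableSet_singleton p), expect]

theorem measurable_smearingOperator {Ω : Type w} [Fintype Ω] [MeasurableSpace Ω]
    [MeasurableSingletonClass Ω] (γ : Kernel Θ Ω) [IsMarkovKernel γ] (x : Ω → ℝ) :
    Measurable (smearingOperator γ x) := by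
  rw [smearingOperator_eq_sum]
  exact Finset.measurable_sum _ fun p _ =>
    ((γ.measurable_coe (measurableSet_singleton p)).ennreal_toReal).const_smul (x p)

theorem abs_smearingOperator_le {Ω : Type w} [MeasurableSpace Ω] (γ : Kernel Θ Ω)
    [IsMarkovKernel γ] {x : Ω → ℝ} (hx : ∀ p, |x p| ≤ 1) (t : Θ) :
    |smearingOperator γ x t| ≤ 1 := by
  have := norm_integral_le_of_norm_le_const (μ := γ t) (C := 1) (f := x)
    (Eventually.of_forall hx)
  simpa [smearingOperator] using this

/-- Every joint observable of two noncommuting registrations is noisy. -/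
theorem IsJointObservable.half_norm_commutator_le_inherentNoise {L N : ℕ}
    {C : POVM H (Fin L × Fin N)} {A : POVM H (Fin L)} {A' : POVM H (Fin N)}
    (hC : C.IsJointObservable A A') {x : Fin L → ℝ} {y : Fin N → ℝ} (hx : ∀ i, |x i| ≤ 1)
    (hy : ∀ j, |y j| ≤ 1) {U V : H →L[ℂ] H} (hU : U = ∑ i, x i • A.measure {i})
    (hV : V = ∑ j, y j • A'.measure {j}) :
    ENNReal.ofReal (‖U * V - V * U‖ / 2) ≤ inherentNoise.{u, v, 0} C := by
  refine le_sInf ?_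
  rintro r ⟨Θ, _, _, _, _, _, _, B, γ, hγ, hB, rfl⟩
  -- A function of one index integrates against `C` to a combination of one marginal, and `Γ`
  -- carries that integral over to `B`.
  let X : Fin L × Fin N → ℝ := fun p => x p.1
  let Y : Fin L × Fin N → ℝ := fun p => y p.2
  have hX : B.expect (smearingOperator γ X) = U := by
    rw [hB.expect_smearingOperator, hU, Fintype.sum_prod_type]
    exact Finset.sum_congr rfl fun i _ => by rw [hC.1, Finset.smul_sum]
  have hY : B.expect (smearingOperator γ Y) = V := by
    rw [hB.expect_smearingOperator, hV, Fintype.sum_prod_type_right]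
    exact Finset.sum_congr rfl fun i _ => by rw [hC.2, Finset.smul_sum]
  have key := B.norm_commutator_expect_le (measurable_smearingOperator γ X)
    (measurable_smearingOperator γ Y) (abs_smearingOperator_le γ fun p => hx p.1)
    (abs_smearingOperator_le γ fun p => hy p.2)
  rw [hX, hY] at key
  have mX : X ∈ testFunctions (Fin L × Fin N) := ⟨measurable_of_finite X, fun p => hx p.1⟩
  have mY : Y ∈ testFunctions (Fin L × Fin N) := ⟨measurable_of_finite Y, fun p => hy p.2⟩
  -- The larger of the two noises is at least half their sum.
  rcases le_total ‖B.noiseOperator (smearingOperator γ X)‖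
    ‖B.noiseOperator (smearingOperator γ Y)‖ with h | h
  · refine le_trans ?_ (le_iSup₂ (f := fun x (_ : x ∈ testFunctions (Fin L × Fin N)) =>
      ‖B.noiseOperator (smearingOperator γ x)‖ₑ) Y mY)
    rw [← ofReal_norm]
    exact ENNReal.ofReal_le_ofReal (by linarith)
  · refine le_trans ?_ (le_iSup₂ (f := fun x (_ : x ∈ testFunctions (Fin L × Fin N)) =>
      ‖B.noiseOperator (smearingOperator γ x)‖ₑ) X mX)
    rw [← ofReal_norm]
    exact ENNReal.ofReal_le_ofReal (by linarith)

end POVM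

/-! ### A transition interval in the cover. -/

/-- The two endpoints of an overlap of consecutive intervals near `0` separate the intervals of the
cover into two groups. -/
theorem IsIntervalCover.exists_transition {c : ℝ} {N : ℕ} {W : Fin N → Set ℝ}
    (hW : IsIntervalCover c W) (hN : 0 < N) (hc : c / N ≤ 1 / 4) :
    ∃ (k : ℕ) (a b : ℝ), a < b ∧ b - a ≤ c / N ∧ -(1 / 4) ≤ a ∧ b ≤ 1 / 4 ∧
      (∀ i : Fin N, k < i → a ∉ W i) ∧ ∀ i : Fin N, (i : ℕ) ≤ k → b ∉ W i := by
  have hopen (i : Fin N) : IsOpen (W i) := by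
    obtain ⟨a, b, -, -, h⟩ := hW.isInterval i
    rw [h]; exact isOpen_Ioo
  obtain ⟨k, hk⟩ := mem_iUnion.mp (hW.covers (show (0 : ℝ) ∈ Icc (-1) 1 by norm_num))
  obtain ⟨a₁, b₁, -, hlen, hWk⟩ := hW.isInterval k
  have hk0 : a₁ < 0 ∧ 0 < b₁ := by rw [hWk] at hk; exact hk
  -- An interval of length at most `1/4` around `0` misses both `-1` and `1`, so it is neither first
  -- nor last, and `k + 1` is a valid index.
  have hm1 : (-1 : ℝ) ∉ W k := by rw [hWk]; intro h; linarith [h.1]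
  have h1 : (1 : ℝ) ∉ W k := by rw [hWk]; intro h; linarith [h.2]
  have hkpos : 0 < (k : ℕ) := by
    by_contra h; exact hm1 (hW.first k (by omega))
  have hklt : (k : ℕ) + 1 < N := by
    by_contra h; exact h1 (hW.last k (by omega))
  have hmeet {i j : Fin N} {t : ℝ} (hi : t ∈ W i) (hj : t ∈ W j) : |(i : ℤ) - (j : ℤ)| < 2 := by
    by_contra h
    exact (hW.disjoint i j (not_lt.mp h)).subset ⟨hi, hj⟩
  -- `L` and `R` are open and cover `[-1, 1]`, and by the disjointness condition they can meet only
  -- inside `W_k ∩ W_{k+1}`. Connectedness makes this intersection nonempty; its endpoints are the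
  -- required `a` and `b`.
  set L : Set ℝ := ⋃ (i : Fin N) (_ : (i : ℕ) ≤ k), W i with hL
  set R : Set ℝ := ⋃ (i : Fin N) (_ : (k : ℕ) < i), W i with hR
  have hLo : IsOpen L := isOpen_iUnion fun i => isOpen_iUnion fun _ => hopen i
  have hRo : IsOpen R := isOpen_iUnion fun i => isOpen_iUnion fun _ => hopen i
  have memL {t : ℝ} : t ∈ L ↔ ∃ i : Fin N, (i : ℕ) ≤ k ∧ t ∈ W i := by simp [hL]
  have memR {t : ℝ} : t ∈ R ↔ ∃ i : Fin N, (k : ℕ) < i ∧ t ∈ W i := by simp [hR]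
  have hcov : Icc (-1 : ℝ) 1 ⊆ L ∪ R := fun t ht => by
    obtain ⟨i, hi⟩ := mem_iUnion.mp (hW.covers ht)
    rcases le_or_gt (i : ℕ) k with h | h
    · exact Or.inl (memL.mpr ⟨i, h, hi⟩)
    · exact Or.inr (memR.mpr ⟨i, h, hi⟩)
  let l : Fin N := ⟨k + 1, hklt⟩
  have hinter : L ∩ R ⊆ W k ∩ W l := by
    rintro t ⟨hl, hr⟩
    obtain ⟨i, hi, hti⟩ := memL.mp hl
    obtain ⟨j, hj, htj⟩ := memR.mp hr
    have := abs_lt.mp (hmeet hti htj)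
    have hik : i = k := Fin.ext (by omega)
    have hjl : j = l := Fin.ext (by simp only [l]; omega)
    exact ⟨hik ▸ hti, hjl ▸ htj⟩
  have hm1L : (-1 : ℝ) ∈ L := memL.mpr ⟨⟨0, hN⟩, Nat.zero_le _, hW.first _ rfl⟩
  have h1R : (1 : ℝ) ∈ R :=
    memR.mpr ⟨⟨N - 1, by omega⟩, by simp only; omega, hW.last _ (by simp only; omega)⟩
  obtain ⟨a₂, b₂, -, -, hWl⟩ := hW.isInterval l
  rw [hWk, hWl, Ioo_inter_Ioo] at hinter
  obtain ⟨t, -, ht⟩ := isPreconnected_Icc (a := (-1 : ℝ)) (b := 1) L R hLo hRo hcov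
    ⟨-1, by norm_num, hm1L⟩ ⟨1, by norm_num, h1R⟩
  have ht' := hinter ht
  have hab := ht'.1.trans ht'.2
  have ha : a₁ ≤ max a₁ a₂ := le_max_left _ _
  have hb : min b₁ b₂ ≤ b₁ := min_le_left _ _
  refine ⟨k, _, _, hab, by linarith, by linarith, by linarith, fun i hi hmem => ?_,
    fun i hi hmem => ?_⟩
  -- If `a` were in `R`, connectedness of `[-1, a]` would put a point of `L ∩ R` at or left of `a`,
  -- whereas `L ∩ R` lies strictly to its right. The case of `b` is symmetric.
  · obtain ⟨s, hs, hs'⟩ := isPreconnected_Icc (a := (-1 : ℝ)) (b := max a₁ a₂) L R hLo hRo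
      ((Icc_subset_Icc_right (by linarith)).trans hcov) ⟨-1, ⟨le_rfl, by linarith⟩, hm1L⟩
      ⟨_, ⟨by linarith, le_rfl⟩, memR.mpr ⟨i, hi, hmem⟩⟩
    exact absurd (hinter hs').1 (not_lt.mpr hs.2)
  · obtain ⟨s, hs, hs'⟩ := isPreconnected_Icc (a := min b₁ b₂) (b := (1 : ℝ)) L R hLo hRo
      ((Icc_subset_Icc_left (by linarith)).trans hcov)
      ⟨_, ⟨le_rfl, by linarith⟩, memL.mpr ⟨i, hi, hmem⟩⟩ ⟨1, ⟨by linarith, le_rfl⟩, h1R⟩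
    exact absurd (hinter hs').2 (not_lt.mpr hs.1)

/-! ### Combinations of a partition of unity and the uniform norm. -/

section Sphere

theorem smoothFun_sum_smul_apply {L : ℕ} (s : Fin L → ℝ) (f : Fin L → SmoothFun) (q : S2) :
    (∑ i, s i • f i) q = ∑ i, s i * f i q :=
  (congrFun (map_sum (ContMDiffMap.coeFnAddMonoidHom (I := 𝓡 2) (N := S2) (I' := 𝓘(ℝ))
    (G := ℝ) (n := ∞)) (fun i => s i • f i) Finset.univ) q).trans (Finset.sum_apply _ _ _)

theorem Partition.sum_smul_apply_eq {L : ℕ} (f : Partition L) {s : Fin L → ℝ} {q : S2} {c : ℝ}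
    (h : ∀ i, f i q ≠ 0 → s i = c) : (∑ i, s i • f i : SmoothFun) q = c := by
  have h1 : ∑ i, f i q = 1 := by
    rw [← finsum_eq_sum_of_fintype]; exact f.sum_eq_one (mem_univ q)
  rw [smoothFun_sum_smul_apply]
  calc ∑ i, s i * f i q = ∑ i, c * f i q := by
        refine Finset.sum_congr rfl fun i _ => ?_
        by_cases hi : f i q = 0
        · rw [hi, mul_zero, mul_zero]
        · rw [h i hi]
    _ = c := by rw [← Finset.mul_sum, h1, mul_one]

theorem abs_le_supNorm (f : SmoothFun) (q : S2) : |f q| ≤ supNorm f := by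
  have hc : Continuous fun q : S2 => |f q| := f.contMDiff.continuous.abs
  exact le_ciSup (isCompact_range hc).bddAbove q

end Sphere

/-! ### A Jacobian estimate from Green's formula. -/

section Plane

/-- A map from a rectangle to the plane which sends the sides of the rectangle to the sides of the
square `[-1, 1]²` has large Jacobian somewhere. -/
theorem four_le_mul_area_of_jacobian_le {F G : ℝ × ℝ → ℝ} {O : Set (ℝ × ℝ)} (hO : IsOpen O)
    (hF : ContDiffOn ℝ ∞ F O) (hG : ContDiffOn ℝ ∞ G O) {a₁ b₁ a₂ b₂ K : ℝ} (h₁ : a₁ ≤ b₁)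
    (h₂ : a₂ ≤ b₂) (hsub : Icc a₁ b₁ ×ˢ Icc a₂ b₂ ⊆ O)
    (hFa : ∀ p ∈ O, p.1 = a₁ → F p = -1) (hFb : ∀ p ∈ O, p.1 = b₁ → F p = 1)
    (hGa : ∀ p ∈ O, p.2 = a₂ → G p = -1) (hGb : ∀ p ∈ O, p.2 = b₂ → G p = 1)
    (hK : ∀ p ∈ Icc a₁ b₁ ×ˢ Icc a₂ b₂, fderiv ℝ F p (1, 0) * fderiv ℝ G p (0, 1)
      - fderiv ℝ F p (0, 1) * fderiv ℝ G p (1, 0) ≤ K) :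
    4 ≤ K * ((b₁ - a₁) * (b₂ - a₂)) := by
  have cF {p} (hp : p ∈ O) : ContDiffAt ℝ ∞ F p := hF.contDiffAt (hO.mem_nhds hp)
  have cG {p} (hp : p ∈ O) : ContDiffAt ℝ ∞ G p := hG.contDiffAt (hO.mem_nhds hp)
  have dF {p} (hp : p ∈ O) : HasFDerivAt F (fderiv ℝ F p) p :=
    ((cF hp).differentiableAt (by simp)).hasFDerivAt
  have dG {p} (hp : p ∈ O) : HasFDerivAt G (fderiv ℝ G p) p :=
    ((cG hp).differentiableAt (by simp)).hasFDerivAt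
  have cF' : ContinuousOn (fderiv ℝ F) O := hF.continuousOn_fderiv_of_isOpen hO (by simp)
  have cG' : ContinuousOn (fderiv ℝ G) O := hG.continuousOn_fderiv_of_isOpen hO (by simp)
  have dG' {p} (hp : p ∈ O) : HasFDerivAt (fderiv ℝ G) (fderiv ℝ (fderiv ℝ G) p) p :=
    (((cG hp).fderiv_right (m := ∞) (by simp)).differentiableAt (by simp)).hasFDerivAt
  have symm {p} (hp : p ∈ O) (v w : ℝ × ℝ) :
      fderiv ℝ (fderiv ℝ G) p v w = fderiv ℝ (fderiv ℝ G) p w v :=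
    (cG hp).isSymmSndFDerivAt
      (by rw [minSmoothness_of_isRCLikeNormedField]; exact WithTop.coe_le_coe.mpr (le_top : (2 : ℕ∞) ≤ ⊤)) v w
  have cJ : ContinuousOn (fun p => fderiv ℝ F p (1, 0) * fderiv ℝ G p (0, 1)
      - fderiv ℝ F p (0, 1) * fderiv ℝ G p (1, 0)) (Icc a₁ b₁ ×ˢ Icc a₂ b₂) := by
    have h (v : ℝ × ℝ) := (cF'.clm_apply (continuousOn_const (c := v))).mono hsub
    have h' (v : ℝ × ℝ) := (cG'.clm_apply (continuousOn_const (c := v))).mono hsub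
    exact ((h _).mul (h' _)).sub ((h _).mul (h' _))
  have dGv (v : ℝ × ℝ) {p} (hp : p ∈ O) : HasFDerivAt (fun p => fderiv ℝ G p v)
      ((fderiv ℝ (fderiv ℝ G) p).flip v) p := by
    have := (dG' hp).clm_apply (hasFDerivAt_const v p)
    simpa using this
  -- The field `(F ∂₂G, -F ∂₁G)` corresponds to the form `F dG`. By symmetry of the second
  -- derivatives of `G` its divergence is the Jacobian of `(F, G)`.
  let f : ℝ × ℝ → ℝ := fun p => F p * fderiv ℝ G p (0, 1)
  let g : ℝ × ℝ → ℝ := fun p => -(F p * fderiv ℝ G p (1, 0))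
  have df {p} (hp : p ∈ O) := (dF hp).mul (dGv (0, 1) hp)
  have dg {p} (hp : p ∈ O) := ((dF hp).mul (dGv (1, 0) hp)).neg
  have hJ {p} (hp : p ∈ O) :
      (F p • (fderiv ℝ (fderiv ℝ G) p).flip (0, 1) + fderiv ℝ G p (0, 1) • fderiv ℝ F p) (1, 0)
      + (-(F p • (fderiv ℝ (fderiv ℝ G) p).flip (1, 0) + fderiv ℝ G p (1, 0) • fderiv ℝ F p)) (0, 1)
      = fderiv ℝ F p (1, 0) * fderiv ℝ G p (0, 1)
        - fderiv ℝ F p (0, 1) * fderiv ℝ G p (1, 0) := by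
    have := symm hp (1, 0) (0, 1)
    simp only [add_apply, smul_apply, neg_apply, ContinuousLinearMap.flip_apply, smul_eq_mul, this]
    ring
  have hcf : ContinuousOn f O := fun p hp => (df hp).continuousAt.continuousWithinAt
  have hcg : ContinuousOn g O := fun p hp => (dg hp).continuousAt.continuousWithinAt
  have green := integral2_divergence_prod_of_hasFDerivAt f g _ _ a₁ a₂ b₁ b₂
    (by rw [uIcc_of_le h₁, uIcc_of_le h₂]; exact hcf.mono hsub)
    (by rw [uIcc_of_le h₁, uIcc_of_le h₂]; exact hcg.mono hsub)
    (fun p hp => by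
      rw [min_eq_left h₁, max_eq_right h₁, min_eq_left h₂, max_eq_right h₂] at hp
      exact df (hsub (prod_mono Ioo_subset_Icc_self Ioo_subset_Icc_self hp)))
    (fun p hp => by
      rw [min_eq_left h₁, max_eq_right h₁, min_eq_left h₂, max_eq_right h₂] at hp
      exact dg (hsub (prod_mono Ioo_subset_Icc_self Ioo_subset_Icc_self hp)))
    (by
      rw [uIcc_of_le h₁, uIcc_of_le h₂]
      exact (cJ.congr fun p hp => hJ (hsub hp)).integrableOn_compact
        (isCompact_Icc.prod isCompact_Icc))
  -- On the horizontal sides `G` is constant, so `F dG` contributes nothing. Constancy along the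
  -- whole line inside `O` covers the corners too.
  have hor {t y c : ℝ} (hp : (t, y) ∈ O) (hc : ∀ p ∈ O, p.2 = y → G p = c) :
      fderiv ℝ G (t, y) (1, 0) = 0 := by
    have h1 : HasDerivAt (fun s : ℝ => G (s, y)) (fderiv ℝ G (t, y) (1, 0)) t :=
      (dG hp).comp_hasDerivAt t ((hasDerivAt_id t).prodMk (hasDerivAt_const t y))
    have h2 : (fun s : ℝ => G (s, y)) =ᶠ[𝓝 t] fun _ => c := by
      have : ContinuousAt (fun s : ℝ => (s, y)) t := by fun_prop
      filter_upwards [this.preimage_mem_nhds (hO.mem_nhds hp)] with s hs using hc _ hs rfl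
    exact h1.unique ((hasDerivAt_const t c).congr_of_eventuallyEq h2)
  -- On each vertical side `G` climbs from `-1` to `1`; with `F = ±1` there, the two sides together
  -- contribute `4`.
  have hver {t : ℝ} (ht : t ∈ Icc a₁ b₁) :
      ∫ y in a₂..b₂, fderiv ℝ G (t, y) (0, 1) = 2 := by
    have hmem {y} (hy : y ∈ Icc a₂ b₂) : (t, y) ∈ O := hsub ⟨ht, hy⟩
    rw [intervalIntegral.integral_eq_sub_of_hasDerivAt (f := fun y => G (t, y))]
    · rw [hGb _ (hmem (right_mem_Icc.mpr h₂)) rfl, hGa _ (hmem (left_mem_Icc.mpr h₂)) rfl]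
      norm_num
    · intro y hy
      rw [uIcc_of_le h₂] at hy
      exact (dG (hmem hy)).comp_hasDerivAt y ((hasDerivAt_const y t).prodMk (hasDerivAt_id y))
    · refine ContinuousOn.intervalIntegrable ?_
      rw [uIcc_of_le h₂]
      refine (cG'.clm_apply (continuousOn_const (c := ((0 : ℝ), (1 : ℝ))))).comp
        (f := fun y => (t, y)) (by fun_prop) fun y hy => hmem hy
  have e1 : ∫ x in a₁..b₁, g (x, b₂) = 0 := by
    rw [← intervalIntegral.integral_zero (a := a₁) (b := b₁) (μ := volume)]
    refine intervalIntegral.integral_congr fun x hx => ?_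
    rw [uIcc_of_le h₁] at hx
    simp only [g]
    rw [hor (hsub ⟨hx, right_mem_Icc.mpr h₂⟩) hGb, mul_zero, neg_zero]
  have e2 : ∫ x in a₁..b₁, g (x, a₂) = 0 := by
    rw [← intervalIntegral.integral_zero (a := a₁) (b := b₁) (μ := volume)]
    refine intervalIntegral.integral_congr fun x hx => ?_
    rw [uIcc_of_le h₁] at hx
    simp only [g]
    rw [hor (hsub ⟨hx, left_mem_Icc.mpr h₂⟩) hGa, mul_zero, neg_zero]
  have e3 : ∫ y in a₂..b₂, f (b₁, y) = 2 := by
    rw [← hver (right_mem_Icc.mpr h₁)]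
    refine intervalIntegral.integral_congr fun y hy => ?_
    rw [uIcc_of_le h₂] at hy
    simp only [f]
    rw [hFb _ (hsub ⟨right_mem_Icc.mpr h₁, hy⟩) rfl, one_mul]
  have e4 : ∫ y in a₂..b₂, f (a₁, y) = -2 := by
    rw [← hver (left_mem_Icc.mpr h₁), ← intervalIntegral.integral_neg]
    refine intervalIntegral.integral_congr fun y hy => ?_
    rw [uIcc_of_le h₂] at hy
    simp only [f]
    rw [hFa _ (hsub ⟨left_mem_Icc.mpr h₁, hy⟩) rfl, neg_one_mul]
  rw [e1, e2, e3, e4] at green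
  have hJcont {x : ℝ} (hx : x ∈ Icc a₁ b₁) : IntervalIntegrable (fun y =>
      fderiv ℝ F (x, y) (1, 0) * fderiv ℝ G (x, y) (0, 1)
        - fderiv ℝ F (x, y) (0, 1) * fderiv ℝ G (x, y) (1, 0)) volume a₂ b₂ := by
    refine ContinuousOn.intervalIntegrable ?_
    rw [uIcc_of_le h₂]
    exact cJ.comp (f := fun y => (x, y)) (by fun_prop) fun y hy => ⟨hx, hy⟩
  have hin {x : ℝ} (hx : x ∈ Icc a₁ b₁) : ∫ y in a₂..b₂, (fderiv ℝ F (x, y) (1, 0)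
      * fderiv ℝ G (x, y) (0, 1) - fderiv ℝ F (x, y) (0, 1) * fderiv ℝ G (x, y) (1, 0))
      ≤ K * (b₂ - a₂) := by
    have := intervalIntegral.integral_mono_on h₂ (hJcont hx) intervalIntegrable_const
      fun y hy => hK (x, y) ⟨hx, hy⟩
    simpa [mul_comm] using this
  have step : ∫ x in a₁..b₁, ∫ y in a₂..b₂, (fderiv ℝ F (x, y) (1, 0)
      * fderiv ℝ G (x, y) (0, 1) - fderiv ℝ F (x, y) (0, 1) * fderiv ℝ G (x, y) (1, 0))
      ≤ K * (b₂ - a₂) * (b₁ - a₁) := by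
    have hint : IntervalIntegrable (fun x => ∫ y in a₂..b₂, (fderiv ℝ F (x, y) (1, 0)
        * fderiv ℝ G (x, y) (0, 1) - fderiv ℝ F (x, y) (0, 1) * fderiv ℝ G (x, y) (1, 0)))
        volume a₁ b₁ := by
      rw [intervalIntegrable_iff_integrableOn_Icc_of_le h₁]
      have := (cJ.integrableOn_compact (μ := volume) (isCompact_Icc.prod isCompact_Icc))
      rw [IntegrableOn, Measure.volume_eq_prod, ← Measure.prod_restrict] at this
      refine this.integral_prod_left.congr (Eventually.of_forall fun x => ?_)
      simp only
      rw [intervalIntegral.integral_of_le h₂, integral_Icc_eq_integral_Ioc]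
    have := intervalIntegral.integral_mono_on h₁ hint intervalIntegrable_const
      fun x hx => hin hx
    rwa [intervalIntegral.integral_const, smul_eq_mul, mul_comm (b₁ - a₁)] at this
  have heq : (∫ x in a₁..b₁, ∫ y in a₂..b₂, (fderiv ℝ F (x, y) (1, 0)
      * fderiv ℝ G (x, y) (0, 1) - fderiv ℝ F (x, y) (0, 1) * fderiv ℝ G (x, y) (1, 0))) = 4 := by
    rw [show (4 : ℝ) = 0 - 0 + 2 - -2 by norm_num, ← green]
    refine intervalIntegral.integral_congr fun x hx => intervalIntegral.integral_congr
      fun y hy => ?_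
    rw [uIcc_of_le h₁] at hx
    rw [uIcc_of_le h₂] at hy
    exact (hJ (hsub ⟨hx, hy⟩)).symm
  linarith [step, heq]

end Plane

/-! ### The upper hemisphere as a graph, and the large Poisson bracket. -/

section Chart

/-- The inverse of the projection of the upper hemisphere to the equatorial plane. -/
def upperChart (p : ℝ × ℝ) : E3 := !₂[p.1, p.2, √(1 - p.1 ^ 2 - p.2 ^ 2)]

/-- The open unit disc. -/
def unitDisc : Set (ℝ × ℝ) := {p | 0 < 1 - p.1 ^ 2 - p.2 ^ 2}

theorem isOpen_unitDisc : IsOpen unitDisc := isOpen_lt continuous_const (by fun_prop)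

theorem norm_upperChart {p : ℝ × ℝ} (hp : p ∈ unitDisc) : ‖upperChart p‖ = 1 := by
  have : 0 < 1 - p.1 ^ 2 - p.2 ^ 2 := hp
  rw [EuclideanSpace.norm_eq, Fin.sum_univ_three]
  simp [upperChart, Real.sq_sqrt this.le]

theorem upperChart_ne_zero {p : ℝ × ℝ} (hp : p ∈ unitDisc) : upperChart p ≠ 0 := by
  intro h; have := norm_upperChart hp; simp [h] at this

/-- The point of the upper hemisphere over a point of the disc. -/
def upperPoint {p : ℝ × ℝ} (hp : p ∈ unitDisc) : S2 :=
  ⟨upperChart p, by simp [norm_upperChart hp]⟩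

theorem radialExt_upperChart (f : SmoothFun) {p : ℝ × ℝ} (hp : p ∈ unitDisc) :
    radialExt f (upperChart p) = f (upperPoint hp) := by
  rw [radialExt, dif_neg (upperChart_ne_zero hp)]
  congr 1
  exact Subtype.ext (by simp [norm_upperChart hp, upperPoint])

theorem contDiffAt_upperChart {p : ℝ × ℝ} (hp : p ∈ unitDisc) :
    ContDiffAt ℝ ∞ upperChart p := by
  have : 0 < 1 - p.1 ^ 2 - p.2 ^ 2 := hp
  rw [contDiffAt_euclidean]
  intro i
  fin_cases i
  · exact contDiffAt_fst
  · exact contDiffAt_snd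
  · exact ContDiffAt.sqrt (by fun_prop) this.ne'

theorem contDiffOn_comp_upperChart (f : SmoothFun) :
    ContDiffOn ℝ ∞ (fun p => radialExt f (upperChart p)) unitDisc := fun p hp =>
  ((contDiffAt_radialExt f (upperChart_ne_zero hp)).comp p
    (contDiffAt_upperChart hp)).contDiffWithinAt

theorem fderiv_upperChart {p : ℝ × ℝ} (hp : p ∈ unitDisc) (v : ℝ × ℝ) :
    fderiv ℝ upperChart p v =
      !₂[v.1, v.2, -(p.1 * v.1 + p.2 * v.2) / √(1 - p.1 ^ 2 - p.2 ^ 2)] := by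
  have hpos : 0 < 1 - p.1 ^ 2 - p.2 ^ 2 := hp
  have hd : HasFDerivAt upperChart (fderiv ℝ upperChart p) p :=
    ((contDiffAt_upperChart hp).differentiableAt (by simp)).hasFDerivAt
  have hd' (i : Fin 3) : HasFDerivAt (fun p => upperChart p i)
      ((EuclideanSpace.proj i : E3 →L[ℝ] ℝ).comp (fderiv ℝ upperChart p)) p :=
    (EuclideanSpace.proj i : E3 →L[ℝ] ℝ).hasFDerivAt.comp p hd
  have hz : HasFDerivAt (fun p : ℝ × ℝ => √(1 - p.1 ^ 2 - p.2 ^ 2)) _ p :=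
    (((hasFDerivAt_const (1 : ℝ) p).sub (hasFDerivAt_fst.pow 2)).sub
      (hasFDerivAt_snd.pow 2)).sqrt hpos.ne'
  ext i
  fin_cases i
  · exact DFunLike.congr_fun ((hd' 0).unique hasFDerivAt_fst) v
  · exact DFunLike.congr_fun ((hd' 1).unique hasFDerivAt_snd) v
  · refine (DFunLike.congr_fun ((hd' 2).unique hz) v).trans ?_
    have : √(1 - p.1 ^ 2 - p.2 ^ 2) ≠ 0 := (Real.sqrt_pos.mpr hpos).ne'
    simp
    field_simp
    ring

theorem fderiv_comp_upperChart (f : SmoothFun) {p : ℝ × ℝ} (hp : p ∈ unitDisc) (v : ℝ × ℝ) :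
    fderiv ℝ (fun p => radialExt f (upperChart p)) p v =
      sphereGrad f (upperPoint hp) 0 * v.1 + sphereGrad f (upperPoint hp) 1 * v.2
      - sphereGrad f (upperPoint hp) 2 * ((p.1 * v.1 + p.2 * v.2) / √(1 - p.1 ^ 2 - p.2 ^ 2)) := by
  have h1 : DifferentiableAt ℝ (radialExt f) (upperChart p) :=
    (contDiffAt_radialExt f (upperChart_ne_zero hp)).differentiableAt (by simp)
  have h2 : DifferentiableAt ℝ upperChart p :=
    (contDiffAt_upperChart hp).differentiableAt (by simp)
  have h3 : fderiv ℝ (fun p => radialExt f (upperChart p)) p v =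
      fderiv ℝ (radialExt f) (upperChart p) (fderiv ℝ upperChart p v) := by
    change fderiv ℝ (radialExt f ∘ upperChart) p v = _
    rw [fderiv_comp p h1 h2]; rfl
  rw [h3, fderiv_upperChart hp, ← inner_gradient_left]
  change inner ℝ (sphereGrad f (upperPoint hp)) _ = _
  rw [PiLp.inner_apply, Fin.sum_univ_three]
  simp
  ring

/-- In the coordinates `q₁, q₂` on the upper hemisphere the area form is `dq₁ ∧ dq₂ / q₃`. -/
theorem jacobian_upperChart (f g : SmoothFun) {p : ℝ × ℝ} (hp : p ∈ unitDisc) :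
    fderiv ℝ (fun p => radialExt f (upperChart p)) p (1, 0) *
        fderiv ℝ (fun p => radialExt g (upperChart p)) p (0, 1)
      - fderiv ℝ (fun p => radialExt f (upperChart p)) p (0, 1) *
        fderiv ℝ (fun p => radialExt g (upperChart p)) p (1, 0)
      = -poissonBracket f g (upperPoint hp) / √(1 - p.1 ^ 2 - p.2 ^ 2) := by
  have hpos : 0 < 1 - p.1 ^ 2 - p.2 ^ 2 := hp
  have hz : √(1 - p.1 ^ 2 - p.2 ^ 2) ≠ 0 := (Real.sqrt_pos.mpr hpos).ne'
  have hpb : poissonBracket f g (upperPoint hp) = -Matrix.det (Matrix.of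
      ![(upperPoint hp : E3).ofLp, (sphereGrad f (upperPoint hp)).ofLp,
        (sphereGrad g (upperPoint hp)).ofLp]) := rfl
  have q0 : (upperPoint hp : E3).ofLp 0 = p.1 := rfl
  have q1 : (upperPoint hp : E3).ofLp 1 = p.2 := rfl
  have q2 : (upperPoint hp : E3).ofLp 2 = √(1 - p.1 ^ 2 - p.2 ^ 2) := rfl
  simp only [fderiv_comp_upperChart _ hp]
  rw [hpb, Matrix.det_fin_three]
  simp only [Matrix.of_apply, Matrix.cons_val_zero, Matrix.cons_val_one, Matrix.cons_val, q0, q1, q2]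
  field_simp
  ring

/-- Over `[a, b]² ⊆ [-1/4, 1/4]²` one has `q₃ ≥ 1/2`, so the Jacobian `-{f, g} / q₃` is at most `2
‖{f, g}‖`, and the planar estimate applies. -/
theorem two_le_supNorm_poissonBracket_mul {f g : SmoothFun} {a b : ℝ} (hab : a ≤ b)
    (ha : -(1 / 4) ≤ a) (hb : b ≤ 1 / 4) (hfa : ∀ q, coord 0 q = a → f q = -1)
    (hfb : ∀ q, coord 0 q = b → f q = 1) (hga : ∀ q, coord 1 q = a → g q = -1)
    (hgb : ∀ q, coord 1 q = b → g q = 1) :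
    2 ≤ supNorm (poissonBracket f g) * (b - a) ^ 2 := by
  have hdisc {p : ℝ × ℝ} (hp : p ∈ Icc a b ×ˢ Icc a b) :
      1 / 4 ≤ 1 - p.1 ^ 2 - p.2 ^ 2 := by
    obtain ⟨⟨h1, h2⟩, h3, h4⟩ := hp
    nlinarith
  have hsub : Icc a b ×ˢ Icc a b ⊆ unitDisc := fun p hp => by
    have := hdisc hp
    change 0 < 1 - p.1 ^ 2 - p.2 ^ 2
    linarith
  have h0 : 0 ≤ supNorm (poissonBracket f g) := Real.iSup_nonneg fun q => abs_nonneg _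
  have key := four_le_mul_area_of_jacobian_le (K := 2 * supNorm (poissonBracket f g))
    isOpen_unitDisc (contDiffOn_comp_upperChart f) (contDiffOn_comp_upperChart g) hab hab hsub
    (fun p hp h => by rw [radialExt_upperChart f hp]; exact hfa _ h)
    (fun p hp h => by rw [radialExt_upperChart f hp]; exact hfb _ h)
    (fun p hp h => by rw [radialExt_upperChart g hp]; exact hga _ h)
    (fun p hp h => by rw [radialExt_upperChart g hp]; exact hgb _ h)
    (fun p hp => by
      rw [jacobian_upperChart f g (hsub hp)]
      have hz : 1 / 2 ≤ √(1 - p.1 ^ 2 - p.2 ^ 2) :=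
        Real.le_sqrt_of_sq_le (by linarith [hdisc hp])
      have h := (neg_le_abs _).trans (abs_le_supNorm (poissonBracket f g) (upperPoint (hsub hp)))
      rw [div_le_iff₀ (by linarith)]
      nlinarith)
  nlinarith [key]

end Chart

/-- Partitions of unity subordinated to the two covers have linear combinations, with coefficients
in `[-1, 1]`, whose Poisson bracket is of order `N²`. -/
theorem IsIntervalCover.exists_large_poissonBracket {c : ℝ} (hc : 0 < c) {N : ℕ}
    {W : Fin N → Set ℝ} (hW : IsIntervalCover c W) (hN : 0 < N) (hcN : c / N ≤ 1 / 4)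
    {f g : Partition N} (hf : f.IsSubordinate (coordCover 0 W))
    (hg : g.IsSubordinate (coordCover 1 W)) :
    ∃ s : Fin N → ℝ, (∀ i, |s i| ≤ 1) ∧
      2 * (N : ℝ) ^ 2 / c ^ 2 ≤
        supNorm (poissonBracket (∑ i, s i • f i) (∑ i, s i • g i)) := by
  obtain ⟨k, a, b, hab, hlen, ha, hb, hka, hkb⟩ := hW.exists_transition hN hcN
  -- Over `a` only indices `≤ k` are active and over `b` only indices `> k`, so the same signs serve
  -- both partitions.
  let s : Fin N → ℝ := fun i => if (i : ℕ) ≤ k then -1 else 1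
  have mem {l : Fin 3} {f : Partition N} (hf : f.IsSubordinate (coordCover l W)) {i : Fin N}
      {q : S2} (h : f i q ≠ 0) : coord l q ∈ W i := hf i (subset_tsupport _ h)
  have hlo {l : Fin 3} {f : Partition N} (hf : f.IsSubordinate (coordCover l W)) (q : S2)
      (hq : coord l q = a) : (∑ i, s i • f i : SmoothFun) q = -1 :=
    f.sum_smul_apply_eq fun i hi => by
      have := mem hf hi
      rw [hq] at this
      exact if_pos (not_lt.mp fun h => hka i h this)
  have hhi {l : Fin 3} {f : Partition N} (hf : f.IsSubordinate (coordCover l W)) (q : S2)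
      (hq : coord l q = b) : (∑ i, s i • f i : SmoothFun) q = 1 :=
    f.sum_smul_apply_eq fun i hi => by
      have := mem hf hi
      rw [hq] at this
      exact if_neg fun h => hkb i h this
  refine ⟨s, fun i => by simp only [s]; split_ifs <;> simp, ?_⟩
  have key := two_le_supNorm_poissonBracket_mul hab.le ha hb (hlo hf) (hhi hf) (hlo hg) (hhi hg)
  set S := supNorm (poissonBracket (∑ i, s i • f i) (∑ i, s i • g i))
  have hS : 0 ≤ S := Real.iSup_nonneg fun q => abs_nonneg _
  have hN' : (0 : ℝ) < N := by exact_mod_cast hN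
  have h2 : 2 ≤ S * (c / N) ^ 2 := key.trans (by gcongr)
  rw [div_le_iff₀ (by positivity)]
  rw [div_pow, mul_div_assoc', le_div_iff₀ (by positivity)] at h2
  exact h2

/-! ### Spectral measures, eigenstates and error bars. -/

section ErrorBars

variable {H : Type u} [NormedAddCommGroup H] [InnerProductSpace ℂ H]

open Classical in
theorem POVM.discrete_measure_apply {Θ : Type v} [MeasurableSpace Θ] {ι : Type w} [Fintype ι]
    {a : ι → H →L[ℂ] H} (ha : ∀ i, (a i).IsPositive) (hsum : ∑ i, a i = 1) (s : ι → Θ) {X : Set Θ}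
    (hX : MeasurableSet X) :
    (POVM.discrete a ha hsum s).measure X = ∑ i, if s i ∈ X then a i else 0 := by
  change (∑ i, VectorMeasure.dirac (s i) (a i) : VectorMeasure Θ (H →L[ℂ] H)) X = _
  rw [FunLike.coe_sum, Finset.sum_apply]
  refine Finset.sum_congr rfl fun i _ => ?_
  split_ifs with hi
  · rw [VectorMeasure.dirac_apply_of_mem hX hi]
  · rw [VectorMeasure.dirac_apply_of_notMem hi]

theorem prob_rankOne [FiniteDimensional ℂ H] {e : H} {B : POVM H ℝ} {X : Set ℝ} :
    prob (InnerProductSpace.rankOne ℂ e e) B X = (inner ℂ e (B.measure X e)).re := by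
  have h : ((InnerProductSpace.rankOne ℂ e e * B.measure X : H →L[ℂ] H) : H →ₗ[ℂ] H)
      = ((InnerProductSpace.rankOne ℂ e e : H →L[ℂ] H) : H →ₗ[ℂ] H)
        * (B.measure X : H →ₗ[ℂ] H) := rfl
  have h' : (B.measure X : H →ₗ[ℂ] H)
      * ((InnerProductSpace.rankOne ℂ e e : H →L[ℂ] H) : H →ₗ[ℂ] H)
      = ((InnerProductSpace.rankOne ℂ (B.measure X e) e : H →L[ℂ] H) : H →ₗ[ℂ] H) := by
    ext ξ; simp
  rw [prob, h, LinearMap.trace_mul_comm, h', InnerProductSpace.trace_rankOne]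

theorem isState_rankOne [FiniteDimensional ℂ H] {e : H} (he : ‖e‖ = 1) :
    IsState (InnerProductSpace.rankOne ℂ e e) :=
  ⟨InnerProductSpace.isPositive_rankOne_self e, by
    rw [InnerProductSpace.trace_rankOne, inner_self_eq_norm_sq_to_K, he]; simp⟩

variable [CompleteSpace H]

theorem isSymmetric_of_selfAdjoint (E : selfAdjoint (H →L[ℂ] H)) :
    ((E : H →L[ℂ] H) : H →ₗ[ℂ] H).IsSymmetric :=
  ContinuousLinearMap.isSelfAdjoint_iff_isSymmetric.mp E.2

variable [FiniteDimensional ℂ H]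

/-- The eigenvalues, with multiplicity, of a Hermitian operator. -/
def eigval (E : selfAdjoint (H →L[ℂ] H)) : Fin (Module.finrank ℂ H) → ℝ :=
  (isSymmetric_of_selfAdjoint E).eigenvalues rfl

/-- An orthonormal basis of eigenvectors of a Hermitian operator. -/
def eigbasis (E : selfAdjoint (H →L[ℂ] H)) :
    OrthonormalBasis (Fin (Module.finrank ℂ H)) ℂ H :=
  (isSymmetric_of_selfAdjoint E).eigenvectorBasis rfl

theorem apply_eigbasis (E : selfAdjoint (H →L[ℂ] H)) (j) :
    (E : H →L[ℂ] H) (eigbasis E j) = (eigval E j : ℂ) • eigbasis E j :=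
  (isSymmetric_of_selfAdjoint E).apply_eigenvectorBasis rfl j

/-- A multiple eigenvalue does no harm: the other projectors in its eigenspace kill the given
eigenvector. -/
theorem sharpObservable_apply_eigbasis (E : selfAdjoint (H →L[ℂ] H)) (j) :
    (sharpObservable E).measure {eigval E j} (eigbasis E j) = eigbasis E j := by
  classical
  have h : (sharpObservable E).measure {eigval E j} = ∑ i,
      if eigval E i ∈ ({eigval E j} : Set ℝ)
        then InnerProductSpace.rankOne ℂ (eigbasis E i) (eigbasis E i) else 0 := by
    convert POVM.discrete_measure_apply
      (fun i => InnerProductSpace.isPositive_rankOne_self (eigbasis E i))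
      (by rw [OrthonormalBasis.sum_rankOne_eq_id]; rfl) (eigval E)
      (measurableSet_singleton (eigval E j))
    rfl
  rw [h, FunLike.coe_sum, Finset.sum_apply, Finset.sum_eq_single j]
  · simp
  · intro i _ hij
    split_ifs
    · rw [InnerProductSpace.rankOne_apply, (eigbasis E).orthonormal.2 hij, zero_smul]
    · rfl
  · simp

/-- If some eigenvalue of `E` is far from all the values of the approximating observable, then the
error bars are wide. -/
theorem le_errorBarWidth_discrete (E : selfAdjoint (H →L[ℂ] H)) {ι : Type*} [Fintype ι]
    {a : ι → H →L[ℂ] H} (ha : ∀ i, (a i).IsPositive) (hsum : ∑ i, a i = 1) {x : ι → ℝ} {ε d : ℝ}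
    (hε : ε < 1) {j : Fin (Module.finrank ℂ H)} (hd : ∀ k, d ≤ |x k - eigval E j|) :
    ENNReal.ofReal (2 * d) ≤ errorBarWidth ε (POVM.discrete a ha hsum x) (sharpObservable E) := by
  classical
  refine le_iInf₂ fun δ hδ => ENNReal.ofReal_le_ofReal ?_
  by_contra hlt
  have he : ‖eigbasis E j‖ = 1 := (eigbasis E).orthonormal.1 j
  -- The pure eigenstate is certain to yield its eigenvalue, while no `x k` falls in the window
  -- around it. The condition then reads `1 - ε ≤ 0`.
  have h := hδ.2 (eigval E j) _ (isState_rankOne he) (by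
    rw [prob_rankOne, sharpObservable_apply_eigbasis, inner_self_eq_norm_sq_to_K, he]; simp)
  have h0 : (POVM.discrete a ha hsum x).measure
      (Icc (eigval E j - δ / 2) (eigval E j + δ / 2)) = 0 := by
    rw [POVM.discrete_measure_apply _ _ _ measurableSet_Icc]
    refine Finset.sum_eq_zero fun k _ => if_neg fun hk => ?_
    have : |x k - eigval E j| ≤ δ / 2 := abs_le.mpr ⟨by linarith [hk.1], by linarith [hk.2]⟩
    linarith [hd k]
  rw [prob_rankOne, h0, zero_apply, inner_zero_right, Complex.zero_re] at h
  linarith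

/-- Parseval in the eigenbasis: a spectral gap of radius `r` around `p` means `(E - p)² ≥ r²`. -/
theorem sq_mul_norm_sq_le_of_eigval {E : selfAdjoint (H →L[ℂ] H)} {p r : ℝ} (hr : 0 ≤ r)
    (h : ∀ j, r ≤ |eigval E j - p|) (ξ : H) :
    r ^ 2 * ‖ξ‖ ^ 2 ≤ ‖(E : H →L[ℂ] H) ξ - (p : ℂ) • ξ‖ ^ 2 := by
  rw [← (eigbasis E).sum_sq_norm_inner_right ξ, ← (eigbasis E).sum_sq_norm_inner_right,
    Finset.mul_sum]
  refine Finset.sum_le_sum fun j _ => ?_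
  have h1 : inner ℂ (eigbasis E j) ((E : H →L[ℂ] H) ξ)
      = (eigval E j : ℂ) * inner ℂ (eigbasis E j) ξ := by
    have := isSymmetric_of_selfAdjoint E (eigbasis E j) ξ
    rw [ContinuousLinearMap.coe_coe, apply_eigbasis, inner_smul_left, Complex.conj_ofReal] at this
    exact this.symm
  rw [inner_sub_right, h1, inner_smul_right, ← sub_mul, norm_mul, mul_pow, ← Complex.ofReal_sub,
    Complex.norm_real, Real.norm_eq_abs]
  gcongr
  exact h j

end ErrorBars

theorem exists_coord_eq (k : Fin 3) {p : ℝ} (hp : p ∈ Icc (-1 : ℝ) 1) :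
    ∃ q : S2, coord k q = p := by
  have h : 0 ≤ 1 - p ^ 2 := by nlinarith [hp.1, hp.2]
  let e : E3 := EuclideanSpace.single k p + EuclideanSpace.single (k + 1) √(1 - p ^ 2)
  have he : ‖e‖ = 1 := by
    rw [EuclideanSpace.norm_eq, Fin.sum_univ_three]
    fin_cases k <;> simp [e, Real.sq_sqrt h]
  refine ⟨⟨e, by simp [he]⟩, ?_⟩
  change e k = p
  fin_cases k <;> simp [e]

theorem abs_coord_le (k : Fin 3) (q : S2) : |coord k q| ≤ 1 := by
  have h : ‖(q : E3)‖ = 1 := by simp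
  exact (PiLp.norm_apply_le (q : E3) k).trans_eq h

/-! ### Semiclassical estimates for noise and error bars. -/

namespace BTQuantization

variable (Q : BTQuantization.{u})

theorem map_one' (m : ℕ) : Q.T m 1 = 1 := Subtype.ext (Q.map_one m)

/-- The spectra of the quantized coordinate functions become dense in `[-1, 1]`. -/
theorem eventually_exists_eigval_near (k : Fin 3) {p r : ℝ} (hp : p ∈ Icc (-1 : ℝ) 1) (hr : 0 < r)
    (hr1 : r ≤ 1) : ∀ᶠ m in atTop, ∃ j, |eigval (Q.T m (coord k)) j - p| < r := by
  let h : SmoothFun := coord k - p • 1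
  -- Since `(q_k - p)² ≤ 4`, the function `D` is nonnegative, with maximum `9` where `q_k = p`. A
  -- spectral gap would give `T_m(h)² ≥ r²`, hence `‖T_m(D)‖ ≤ 9 - r² + r²/3`, against `‖T_m(D)‖ > 9
  -- - r²/3` from the norm asymptotics.
  let D : SmoothFun := (9 : ℝ) • 1 - h * h
  have hq (q : S2) : h q = coord k q - p := by
    change coord k q - p * 1 = _
    rw [mul_one]
  have hDq (q : S2) : D q = 9 - (coord k q - p) ^ 2 := by
    change 9 * 1 - h q * h q = _
    rw [hq]; ring
  have hDpos (q : S2) : 0 ≤ D q := by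
    have := abs_le.mp (abs_coord_le k q)
    rw [hDq]; nlinarith [hp.1, hp.2]
  have hsup : 9 ≤ supNorm D := by
    obtain ⟨q, hq⟩ := exists_coord_eq k hp
    refine le_trans ?_ (abs_le_supNorm D q)
    rw [hDq, hq]; norm_num
  have h3 : 0 < r ^ 2 / 3 := by positivity
  have ev1 := ((Q.norm_asymp D).trans_tendsto tendsto_one_div_atTop_nhds_zero_nat).eventually
    (lt_mem_nhds (neg_lt_zero.mpr h3))
  have ev2 := ((Q.quasi_mult h).trans_tendsto tendsto_one_div_atTop_nhds_zero_nat).eventually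
    (gt_mem_nhds h3)
  filter_upwards [ev1, ev2] with m h1 h2
  by_contra hcon
  push Not at hcon
  set X : Q.H m →L[ℂ] Q.H m := (Q.T m (coord k)).1
  set Z : Q.H m →L[ℂ] Q.H m := (Q.T m (h * h)).1
  have hTh : ∀ ξ, (Q.T m h : Q.H m →L[ℂ] Q.H m) ξ = X ξ - (p : ℂ) • ξ := by
    intro ξ
    simp only [h, map_sub, map_smul, map_one']
    simp [X]
  have hTD : ∀ ξ, (Q.T m D : Q.H m →L[ℂ] Q.H m) ξ = (9 : ℂ) • ξ - Z ξ := by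
    intro ξ
    simp only [D, map_sub, map_smul, map_one']
    have : (((9 : ℝ) • (1 : selfAdjoint (Q.H m →L[ℂ] Q.H m)) : selfAdjoint (Q.H m →L[ℂ] Q.H m)) :
        Q.H m →L[ℂ] Q.H m) ξ = (9 : ℂ) • ξ := by
      change (9 : ℝ) • ξ = _
      rw [← Complex.coe_smul]; norm_num
    rw [AddSubgroupClass.coe_sub, sub_apply, this]
  have hpos := Q.map_nonneg m D hDpos
  have hnorm : ‖(Q.T m D : Q.H m →L[ℂ] Q.H m)‖ ≤ 9 - r ^ 2 + r ^ 2 / 3 := by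
    refine norm_le_of_abs_re_inner_le hpos.isSymmetric (by nlinarith) fun ξ => ?_
    have e0 : 0 ≤ (inner ℂ ((Q.T m D : Q.H m →L[ℂ] Q.H m) ξ) ξ).re := hpos.re_inner_nonneg_left ξ
    rw [abs_of_nonneg e0, hTD, inner_sub_left, inner_smul_left,
      inner_self_eq_norm_sq_to_K, Complex.sub_re]
    have e1 : ((starRingEnd ℂ) 9 * (‖ξ‖ : ℂ) ^ 2).re = 9 * ‖ξ‖ ^ 2 := by
      rw [show (starRingEnd ℂ) 9 * (‖ξ‖ : ℂ) ^ 2 = ((9 * ‖ξ‖ ^ 2 : ℝ) : ℂ) by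
        simp [Complex.conj_ofNat], Complex.ofReal_re]
    have e2 : (inner ℂ (((Q.T m h : Q.H m →L[ℂ] Q.H m) * Q.T m h) ξ) ξ).re
        = ‖(Q.T m h : Q.H m →L[ℂ] Q.H m) ξ‖ ^ 2 := by
      have := isSymmetric_of_selfAdjoint (Q.T m h) ((Q.T m h : Q.H m →L[ℂ] Q.H m) ξ) ξ
      simp only [ContinuousLinearMap.coe_coe] at this
      rw [mul_apply_eq_comp, this, inner_self_eq_norm_sq_to_K]
      norm_cast
    have e3 := re_inner_le_norm_mul
      ((Q.T m h : Q.H m →L[ℂ] Q.H m) * (Q.T m h).1 - Z) ξ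
    rw [norm_sub_rev, sub_apply, inner_sub_left, Complex.sub_re, e2, hTh] at e3
    have e4 := sq_mul_norm_sq_le_of_eigval hr.le hcon ξ
    have e5 : ‖Z - (Q.T m h : Q.H m →L[ℂ] Q.H m) * (Q.T m h).1‖ * ‖ξ‖ ^ 2
        ≤ r ^ 2 / 3 * ‖ξ‖ ^ 2 := by gcongr
    change ((starRingEnd ℂ) 9 * (‖ξ‖ : ℂ) ^ 2).re - (inner ℂ (Z ξ) ξ).re ≤ _
    rw [e1]
    linarith
  linarith

/-- The commutator of two quantized functions is bounded from below by their Poisson bracket. -/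
theorem eventually_le_norm_commutator (f g : SmoothFun) {S : ℝ} (hS : 0 < S)
    (hfg : 2 * S ≤ supNorm (poissonBracket f g)) :
    ∀ᶠ m : ℕ in atTop, S / m ≤ ‖(Q.T m f : Q.H m →L[ℂ] Q.H m) * Q.T m g - Q.T m g * Q.T m f‖ := by
  -- The norm asymptotics and the correspondence principle each cost at most `S / 2` out of `2 S`.
  have h2 : 0 < S / 2 := by positivity
  have ev1 := ((Q.norm_asymp (poissonBracket f g)).trans_tendsto
    tendsto_one_div_atTop_nhds_zero_nat).eventually (lt_mem_nhds (neg_lt_zero.mpr h2))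
  have ev2 := ((Q.correspondence f g).trans_tendsto
    tendsto_one_div_atTop_nhds_zero_nat).eventually (gt_mem_nhds h2)
  filter_upwards [ev1, ev2, eventually_gt_atTop 0] with m h1 h3 hm
  have hm' : (0 : ℝ) < m := by exact_mod_cast hm
  rw [div_le_iff₀ hm']
  have h4 := norm_sub_norm_le (Q.T m (poissonBracket f g) : Q.H m →L[ℂ] Q.H m)
    ((Complex.I * (m : ℂ)) • ((Q.T m f : Q.H m →L[ℂ] Q.H m) * Q.T m g - Q.T m g * Q.T m f))
  rw [norm_sub_rev, norm_smul, norm_mul, Complex.norm_I, one_mul, Complex.norm_natCast] at h4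
  linarith

theorem registration_measure_singleton (m : ℕ) {L : ℕ} (f : Partition L) (i : Fin L) :
    (Q.registration m f).measure {i} = (Q.T m (f i) : Q.H m →L[ℂ] Q.H m) := by
  classical
  rw [registration, POVM.discrete_measure_apply _ _ _ (measurableSet_singleton i)]
  simp

theorem T_sum_smul (m : ℕ) {L : ℕ} (f : Partition L) (s : Fin L → ℝ) :
    (Q.T m (∑ i, s i • f i) : Q.H m →L[ℂ] Q.H m)
      = ∑ i, s i • (Q.registration m f).measure {i} := by
  simp only [registration_measure_singleton, map_sum, map_smul, AddSubgroup.val_finsetSum,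
    selfAdjoint.val_smul]

/-- The bracket of size `2 N² / c²` yields a commutator of norm at least `N² / (c² m)`, and
unsharpness keeps half of it. -/
theorem eventually_le_inherentNoise {c : ℝ} (hc : 0 < c) {N : ℕ} {W : Fin N → Set ℝ}
    (hW : IsIntervalCover c W) (hN : 0 < N) (hcN : c / N ≤ 1 / 4) {f g : Partition N}
    (hf : f.IsSubordinate (coordCover 0 W)) (hg : g.IsSubordinate (coordCover 1 W))
    {C : ∀ m, POVM (Q.H m) (Fin N × Fin N)} (hC : Q.IsJointSequence f g C) :
    ∀ᶠ m : ℕ in atTop, ENNReal.ofReal ((N : ℝ) ^ 2 / (2 * c ^ 2) / m) ≤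
      POVM.inherentNoise.{u, v, 0} (C m) := by
  obtain ⟨s, hs, hbr⟩ := hW.exists_large_poissonBracket hc hN hcN hf hg
  have hN' : (0 : ℝ) < N := by exact_mod_cast hN
  have key := Q.eventually_le_norm_commutator (∑ i, s i • f i) (∑ i, s i • g i)
    (S := (N : ℝ) ^ 2 / c ^ 2) (by positivity) (by rwa [mul_div_assoc'])
  filter_upwards [key] with m hm
  refine le_trans (ENNReal.ofReal_le_ofReal ?_)
    ((hC m).half_norm_commutator_le_inherentNoise hs hs (Q.T_sum_smul m f s) (Q.T_sum_smul m g s))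
  calc (N : ℝ) ^ 2 / (2 * c ^ 2) / m = (N : ℝ) ^ 2 / c ^ 2 / m / 2 := by
        rw [mul_comm (2 : ℝ), ← div_div, div_right_comm]
    _ ≤ _ := by gcongr

theorem eventually_le_errorBarWidth (k : Fin 3) {N : ℕ} (hN : 0 < N) (f : Partition N)
    (x : Fin N → ℝ) {ε : ℕ → ℝ} (hε : ∀ᶠ m in atTop, 0 < ε m ∧ ε m < 1) :
    ∀ᶠ m : ℕ in atTop, ENNReal.ofReal (1 / N) ≤
      errorBarWidth (ε m) (Q.realRegistration m f x) (sharpObservable (Q.T m (coord k))) := by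
  have hN' : (0 : ℝ) < N := by exact_mod_cast hN
  have hN1 : (1 : ℝ) ≤ N := by exact_mod_cast hN
  obtain ⟨p, hp, hfar⟩ : ∃ p ∈ Icc (-1 : ℝ) 1, ∀ i, 1 / N ≤ |x i - p| := by
    by_contra hcon
    push Not at hcon
    -- Pigeonhole on `N + 1` grid points of spacing `2 / N`: two of them within `1 / N` of the same
    -- `x i` would be less than one spacing apart.
    let P : Fin (N + 1) → ℝ := fun j => -1 + 2 * (j : ℕ) / N
    have hP (j) : P j ∈ Icc (-1 : ℝ) 1 := by
      have h1 : ((j : ℕ) : ℝ) ≤ N := by exact_mod_cast Nat.lt_succ_iff.mp j.2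
      have h2 : 2 * ((j : ℕ) : ℝ) / N ≤ 2 := by rw [div_le_iff₀ hN']; linarith
      exact ⟨by simp only [P]; linarith [show 0 ≤ 2 * ((j : ℕ) : ℝ) / N by positivity],
        by simp only [P]; linarith⟩
    choose i hi using fun j => hcon (P j) (hP j)
    obtain ⟨j, j', hne, hij⟩ := Fintype.exists_ne_map_eq_of_card_lt i (by simp)
    have h1 := abs_lt.mp (hi j)
    have h2 := abs_lt.mp (hi j')
    rw [← hij] at h2
    have h3 : |P j - P j'| < 2 / N := by
      rw [abs_lt, show (2 : ℝ) / N = 1 / N + 1 / N by ring]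
      constructor <;> linarith
    have h4 : P j - P j' = 2 / N * (((j : ℤ) - (j' : ℤ) : ℤ) : ℝ) := by
      simp only [P]; push_cast; ring
    rw [h4, abs_mul, abs_of_pos (by positivity), mul_lt_iff_lt_one_right (by positivity)] at h3
    have h5 : |(j : ℤ) - (j' : ℤ)| < 1 := by exact_mod_cast h3
    rw [Int.abs_lt_one_iff] at h5
    exact hne (Fin.ext (by omega))
  -- An eigenvalue within `1 / (2N)` of `p` stays at least `1 / (2N)` from every `x i`; the full
  -- width is twice this.
  have hr : 0 < 1 / (2 * (N : ℝ)) := by positivity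
  filter_upwards [Q.eventually_exists_eigval_near k hp hr
    (by rw [div_le_one (by positivity)]; linarith), hε] with m ⟨j, hj⟩ hεm
  have h2 : 1 / (N : ℝ) = 2 * (1 / (2 * (N : ℝ))) := by field_simp
  rw [h2]
  refine le_errorBarWidth_discrete (Q.T m (coord k)) _ _ hεm.2 (j := j) fun i => ?_
  have h3 := abs_sub_le (x i) (eigval (Q.T m (coord k)) j) p
  linarith [hfar i]

end BTQuantization

end SpinNoise

end

/-! ### Assembly of the two bounds. -/

theorem theorem6 (c₁ : ℝ) (hc₁ : 0 < c₁) :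
    ∃ (c₂ c₅ : ℝ) (N₀ : ℕ), 0 < c₂ ∧ 0 < c₅ ∧
      ∀ N : ℕ, N₀ ≤ N → ∀ W : Fin N → Set ℝ, SpinNoise.IsIntervalCover c₁ W →
        -- the noise indicator of the pair of covers
        ENNReal.ofReal (c₂ * (N : ℝ) ^ 2) ≤
          SpinNoise.noiseIndicator.{u, v} (SpinNoise.coordCover 0 W) (SpinNoise.coordCover 1 W) ∧
        -- joint observables of the approximate measurements of two components of spin
        ∀ (Q : SpinNoise.BTQuantization.{u}) (f g : SpinNoise.Partition N),
          f.IsSubordinate (SpinNoise.coordCover 0 W) →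
          g.IsSubordinate (SpinNoise.coordCover 1 W) →
          ∀ C : (m : ℕ) → SpinNoise.POVM (Q.H m) (Fin N × Fin N), Q.IsJointSequence f g C →
          ∀ x y : Fin N → ℝ, (∀ k, x k ∈ W k) → (∀ k, y k ∈ W k) →
          ∀ ε : ℕ → ℝ, (∀ᶠ m in Filter.atTop, 0 < ε m ∧ ε m < 1) →
            ∀ᶠ m : ℕ in Filter.atTop,
              ENNReal.ofReal (c₅ * (1 / (m : ℝ))) ≤
                SpinNoise.POVM.inherentNoise.{u, v, 0} (C m) *
                  SpinNoise.errorBarWidth (ε m) (Q.realRegistration m f x)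
                    (SpinNoise.sharpObservable (Q.T m (SpinNoise.coord 0))) ^ 2 ∧
              ENNReal.ofReal (c₅ * (1 / (m : ℝ))) ≤
                SpinNoise.POVM.inherentNoise.{u, v, 0} (C m) *
                  SpinNoise.errorBarWidth (ε m) (Q.realRegistration m g y)
                    (SpinNoise.sharpObservable (Q.T m (SpinNoise.coord 1))) ^ 2 := by

  -- The threshold for `N` ensures `N > 0` and `c₁ / N ≤ 1/4`.
  refine ⟨1 / (2 * c₁ ^ 2), 1 / (2 * c₁ ^ 2), ⌈4 * c₁⌉₊ + 1, by positivity, by positivity, ?_⟩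
  intro N hN₀ W hW
  have hN : 0 < N := by omega
  have hN' : (0 : ℝ) < N := by exact_mod_cast hN
  have hcN : c₁ / N ≤ 1 / 4 := by
    have h : 4 * c₁ ≤ N := (Nat.le_ceil _).trans (by exact_mod_cast (by omega))
    rw [div_le_iff₀ hN']
    linarith
  constructor
  · refine le_iInf fun Q => le_iInf₂ fun f hf => le_iInf₂ fun g hg => le_iInf₂ fun C hC => ?_
    refine Filter.le_liminf_of_le (by isBoundedDefault) ?_
    filter_upwards [Q.eventually_le_inherentNoise hc₁ hW hN hcN hf hg hC,
      Filter.eventually_gt_atTop 0] with m hm hm0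
    have hm' : (0 : ℝ) < m := by exact_mod_cast hm0
    refine le_trans (le_of_eq ?_) (mul_le_mul_right hm (m : ENNReal))
    rw [← ENNReal.ofReal_natCast, ← ENNReal.ofReal_mul hm'.le]
    congr 1
    field_simp
  · intro Q f g hf hg C hC x y _ _ ε hε
    filter_upwards [Q.eventually_le_inherentNoise hc₁ hW hN hcN hf hg hC,
      Q.eventually_le_errorBarWidth 0 hN f x hε, Q.eventually_le_errorBarWidth 1 hN g y hε,
      Filter.eventually_gt_atTop 0] with m hm hx hy hm0
    have hm' : (0 : ℝ) < m := by exact_mod_cast hm0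
    -- The `N²` of the noise cancels against the square of the width `1 / N`.
    have h : ENNReal.ofReal (1 / (2 * c₁ ^ 2) * (1 / (m : ℝ))) =
        ENNReal.ofReal ((N : ℝ) ^ 2 / (2 * c₁ ^ 2) / m) * ENNReal.ofReal (1 / N) ^ 2 := by
      rw [← ENNReal.ofReal_pow (by positivity), ← ENNReal.ofReal_mul (by positivity)]
      congr 1
      field_simp
    rw [h]
    exact ⟨by gcongr, by gcongr⟩
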